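/- **Theorem 4 (Pointwise MDP for the semi-recursive kernel estimator of the regression).** Let $d,q\ge 1$ and let $(X,Y),(X_1,Y_1),(X_2,Y_2),\dots$ be i.i.d. $\mathbb{R}^d\times\mathbb{R}^q$-valued random vectors with probability density $f(x,y)$ and $\mathbb{E}\|Y\|<\infty$. Put $$g(t)=\int_{\mathbb{R}^q} f(t,y)\,dy,\qquad m(t)=\int_{\mathbb{R}^q} y f(t,y)\,dy,\qquad r(t)=\mathbb{E}(Y\mid X=t)=\frac{m(t)}{g(t)},$$ and let $\Sigma_t=\frac1{g(t)}\int (y-r(t))(y-r(t))^Tf(t,y)\,dy$ be the covariance matrix of $Y$ given $X=t$. Fix $x\in\mathbb{R}^d$, $K:\mathbb{R}^d\to\mathbb{R}$ and positive sequences $(h_n)_{n\ge1}$, $(v_n)_{n\ge1}$, and let $$\tilde m_n(x)=\frac1n\sum_{i=1}^n\frac{Y_i}{h_i^d}K\Big(\frac{x-X_i}{h_i}\Big),\qquad \tilde g_n(x)=\frac1n\sum_{i=1}^n\frac1{h_i^d}K\Big(\frac{x-X_i}{h_i}\Big),$$ and $\tilde r_n(x)=\tilde m_n(x)/\tilde g_n(x)$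 if $\tilde g_n(x)\ne0$, $\tilde r_n(x)=0$ otherwise. Assume: * $(h_n)$ varies regularly with exponent $-a$ for some $a\in(0,1/d)$, i.e. $h_n=u(n)$ for all $n\ge 1$ with a positive measurable $u$ on $(0,\infty)$ such that $u(ct)/u(t)\to c^{-a}$ as $t\to\infty$ for every $c>0$; and $\sup_{n\ge1}\sup_{1\le i\le n} h_n/h_i<\infty$. * (A1) $K$ is bounded and integrable, $\int K=1$, and $K(z)\to0$ as $\|z\|\to\infty$. * (A2) For every $u\in\mathbb{R}^q$, $t\mapsto\int e^{\langle u,y\rangle}f(t,y)\,dy$ is bounded on $\mathbb{R}^d$ and continuous at $x$. * (A3) For every $u\in\mathbb{R}^q$, $t\mapsto\int\langle u,y\rangle^2f(t,y)\,dy$ and $t\mapsto\int\langle u,y\rangle f(t,y)\,dy$ are continuous at $x$, and $g(x)\neq0$. * (A4) $v_n\to\infty$ and $nh_n^d/v_n^2\to\infty$. * (A5) There is an integer $p\ge2$ such that: (i) for all $s\in\{1,\dots,p-1\}$ and $j\in\{1,\dots,d\}$, $\int_{\mathbb{R}} y_j^sK(y)\,dy_j=0$ for almost every value of the other coordinates,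 and $\int_{\mathbb{R}^d}|y_j^pK(y)|\,dy<\infty$; (ii) $v_nh_n^p\to0$; (iii) $m$ and $g$ are $p$ times differentiable on $\mathbb{R}^d$, and their differentials of order $p$ are bounded on $\mathbb{R}^d$ and continuous at $x$. Then $\Sigma_x$ is positive definite and $\big(v_n(\tilde r_n(x)-r(x))\big)_{n\ge1}$ satisfies a large deviations principle with speed $\nu_n=nh_n^d/v_n^2$ and good rate function $$\tilde G_{a,x}(w)=\frac{(1+ad)\,g(x)}{2\int_{\mathbb{R}^d}K^2(z)\,dz}\,w^T\Sigma_x^{-1}w ,\qquad w\in\mathbb{R}^q.$$ That is: $\nu_n>0$ and $\nu_n\to\infty$; $\tilde G_{a,x}\ge 0$ is lower semicontinuous with compact level sets; and $$\liminf_n \nu_n^{-1}\log\mathbb{P}[v_n(\tilde r_n(x)-r(x))\in U]\ge-\inf_U\tilde G_{a,x},\qquad \limsup_n \nu_n^{-1}\log\mathbb{P}[v_n(\tilde r_n(x)-r(x))\in V]\le-\inf_V\tilde G_{a,x}$$ for every open $U\subset\mathbb{R}^q$ and every closed $V\subset\mathbb{R}^q$. Moreover $\tilde G_{a,x}$ is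 larger than the moderate deviations rate $G_x(w)=\frac{g(x)}{2\int K^2}\,w^T\Sigma_x^{-1}w$ of the Nadaraya–Watson estimator: $G_x(w)\le\tilde G_{a,x}(w)$ for all $w$, with strict inequality for $w\ne0$. -/

import Mathlib

open MeasureTheory ProbabilityTheory Filter Topology

noncomputable section

namespace SemiRecursive

/-! ### Large deviations -/

/-- A speed: a sequence (indexed by `n ≥ 1`) of positive numbers going to infinity. -/
structure IsSpeed (ν : ℕ → ℝ) : Prop where
  pos : ∀ n, 1 ≤ n → 0 < ν n
  tendsto : Tendsto ν atTop atTop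

/-- A good rate function: `[0, ∞]`-valued, lower semicontinuous, with compact level sets. -/
structure IsGoodRate {E : Type*} [TopologicalSpace E] (I : E → EReal) : Prop where
  nonneg : ∀ z, 0 ≤ I z
  lsc : LowerSemicontinuous I
  isCompact_level : ∀ α : ℝ, IsCompact {z | I z ≤ (α : EReal)}

/-- The sequence `(Z n)` satisfies, under `P`, the large deviations principle with speed `ν` and
good rate function `I`. Logarithms are extended-real valued, `log 0 = -∞`. -/
structure LDPWithGoodRate {Ω E : Type*} [MeasurableSpace Ω] [TopologicalSpace E]
    (P : Measure Ω) (Z : ℕ → Ω → E) (ν : ℕ → ℝ) (I : E → EReal) : Prop where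
  isSpeed : IsSpeed ν
  isGoodRate : IsGoodRate I
  lower : ∀ U : Set E, IsOpen U →
    -(⨅ z ∈ U, I z) ≤
      liminf (fun n => (((ν n)⁻¹ : ℝ) : EReal) * ENNReal.log (P {ω | Z n ω ∈ U})) atTop
  upper : ∀ V : Set E, IsClosed V →
    limsup (fun n => (((ν n)⁻¹ : ℝ) : EReal) * ENNReal.log (P {ω | Z n ω ∈ V})) atTop ≤
      -(⨅ z ∈ V, I z)

/-! ### Regular variation -/

/-- A positive measurable function `u` on `(0, ∞)` varies regularly (at infinity) with
exponent `ρ` (values of `u` outside `(0, ∞)` play no role). -/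
structure RegularlyVaryingFun (u : ℝ → ℝ) (ρ : ℝ) : Prop where
  measurable : Measurable u
  pos : ∀ t, 0 < t → 0 < u t
  tendsto_ratio : ∀ c : ℝ, 0 < c → Tendsto (fun t => u (c * t) / u t) atTop (𝓝 (c ^ ρ))

/-- A sequence `(h n)`, `n ≥ 1`, varies regularly with exponent `ρ`. -/
def RegularlyVaryingSeq (h : ℕ → ℝ) (ρ : ℝ) : Prop :=
  ∃ u : ℝ → ℝ, RegularlyVaryingFun u ρ ∧ ∀ n : ℕ, 1 ≤ n → h n = u n

section Model

variable {d q : ℕ}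

/-! ### The regression model -/

/-- The marginal density `g(t) = ∫ f(t, y) dy` of `X`. -/
def marginal (f : EuclideanSpace ℝ (Fin d) → EuclideanSpace ℝ (Fin q) → ℝ)
    (t : EuclideanSpace ℝ (Fin d)) : ℝ :=
  ∫ y, f t y

/-- `m(t) = ∫ y f(t, y) dy`. -/
def firstMoment (f : EuclideanSpace ℝ (Fin d) → EuclideanSpace ℝ (Fin q) → ℝ)
    (t : EuclideanSpace ℝ (Fin d)) : EuclideanSpace ℝ (Fin q) :=
  ∫ y, f t y • y

/-- The regression `r(t) = E(Y | X = t) = m(t) / g(t)`. -/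
def regression (f : EuclideanSpace ℝ (Fin d) → EuclideanSpace ℝ (Fin q) → ℝ)
    (t : EuclideanSpace ℝ (Fin d)) : EuclideanSpace ℝ (Fin q) :=
  (marginal f t)⁻¹ • firstMoment f t

/-- The conditional covariance matrix `Σ_t = V(Y | X = t)`, computed with the conditional
density `f(t, ·) / g(t)`. -/
def condCov (f : EuclideanSpace ℝ (Fin d) → EuclideanSpace ℝ (Fin q) → ℝ)
    (t : EuclideanSpace ℝ (Fin d)) : Matrix (Fin q) (Fin q) ℝ :=
  Matrix.of fun k l =>
    (∫ y, (y k - regression f t k) * (y l - regression f t l) * f t y) / marginal f t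

/-- `((X i, Y i))` is an i.i.d. sequence of random vectors with (Borel) probability density `f`
and `E‖Y‖ < ∞`. The index `0` plays the role of the generic pair `(X, Y)`. -/
structure IsSample {Ω : Type*} [MeasurableSpace Ω] (P : Measure Ω)
    (X : ℕ → Ω → EuclideanSpace ℝ (Fin d)) (Y : ℕ → Ω → EuclideanSpace ℝ (Fin q))
    (f : EuclideanSpace ℝ (Fin d) → EuclideanSpace ℝ (Fin q) → ℝ) : Prop where
  measurable_X : ∀ i, Measurable (X i)
  measurable_Y : ∀ i, Measurable (Y i)
  measurable_density : Measurable (Function.uncurry f)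
  density_nonneg : ∀ t y, 0 ≤ f t y
  law : ∀ i, P.map (fun ω => (X i ω, Y i ω)) =
    (volume : Measure (EuclideanSpace ℝ (Fin d) × EuclideanSpace ℝ (Fin q))).withDensity
      (fun z => ENNReal.ofReal (f z.1 z.2))
  indep : iIndepFun (fun i ω => (X i ω, Y i ω)) P
  integrable_Y : ∀ i, Integrable (Y i) P

/-! ### The semi-recursive estimator -/

/-- `m̃_n(x) = (1/n) ∑_{i=1}^n (Y_i / h_i^d) K((x - X_i) / h_i)`. -/
def mTilde {Ω : Type*} (K : EuclideanSpace ℝ (Fin d) → ℝ) (h : ℕ → ℝ)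
    (X : ℕ → Ω → EuclideanSpace ℝ (Fin d)) (Y : ℕ → Ω → EuclideanSpace ℝ (Fin q))
    (x : EuclideanSpace ℝ (Fin d)) (n : ℕ) (ω : Ω) : EuclideanSpace ℝ (Fin q) :=
  (n : ℝ)⁻¹ • ∑ i ∈ Finset.Icc 1 n, (K ((h i)⁻¹ • (x - X i ω)) / h i ^ d) • Y i ω

/-- `g̃_n(x) = (1/n) ∑_{i=1}^n (1 / h_i^d) K((x - X_i) / h_i)`. -/
def gTilde {Ω : Type*} (K : EuclideanSpace ℝ (Fin d) → ℝ) (h : ℕ → ℝ)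
    (X : ℕ → Ω → EuclideanSpace ℝ (Fin d))
    (x : EuclideanSpace ℝ (Fin d)) (n : ℕ) (ω : Ω) : ℝ :=
  (n : ℝ)⁻¹ * ∑ i ∈ Finset.Icc 1 n, K ((h i)⁻¹ • (x - X i ω)) / h i ^ d

open Classical in
/-- The semi-recursive estimator `r̃_n(x)`: `m̃_n(x) / g̃_n(x)` if `g̃_n(x) ≠ 0`, and `0`
otherwise. -/
def rTilde {Ω : Type*} (K : EuclideanSpace ℝ (Fin d) → ℝ) (h : ℕ → ℝ)
    (X : ℕ → Ω → EuclideanSpace ℝ (Fin d)) (Y : ℕ → Ω → EuclideanSpace ℝ (Fin q))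
    (x : EuclideanSpace ℝ (Fin d)) (n : ℕ) (ω : Ω) : EuclideanSpace ℝ (Fin q) :=
  if gTilde K h X x n ω ≠ 0 then (gTilde K h X x n ω)⁻¹ • mTilde K h X Y x n ω else 0

/-! ### The rate functions -/

/-- The quadratic form `v ↦ vᵀ Σ_x⁻¹ v`. -/
def precisionForm (f : EuclideanSpace ℝ (Fin d) → EuclideanSpace ℝ (Fin q) → ℝ)
    (x : EuclideanSpace ℝ (Fin d)) (v : EuclideanSpace ℝ (Fin q)) : ℝ :=
  v.ofLp ⬝ᵥ (Matrix.mulVec (condCov f x)⁻¹ v.ofLp)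

/-- The moderate deviations rate of the Nadaraya-Watson estimator,
`G_x(v) = g(x) / (2 ∫ K²) * vᵀ Σ_x⁻¹ v`. -/
def nadarayaWatsonRate (K : EuclideanSpace ℝ (Fin d) → ℝ)
    (f : EuclideanSpace ℝ (Fin d) → EuclideanSpace ℝ (Fin q) → ℝ)
    (x : EuclideanSpace ℝ (Fin d)) (v : EuclideanSpace ℝ (Fin q)) : ℝ :=
  marginal f x / (2 * ∫ z, K z ^ 2) * precisionForm f x v

/-- The moderate deviations rate of the semi-recursive estimator,
`G̃_{a,x}(v) = (1 + a d) g(x) / (2 ∫ K²) * vᵀ Σ_x⁻¹ v`. -/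
def semiRecursiveRate (a : ℝ) (K : EuclideanSpace ℝ (Fin d) → ℝ)
    (f : EuclideanSpace ℝ (Fin d) → EuclideanSpace ℝ (Fin q) → ℝ)
    (x : EuclideanSpace ℝ (Fin d)) (v : EuclideanSpace ℝ (Fin q)) : ℝ :=
  (1 + a * d) * marginal f x / (2 * ∫ z, K z ^ 2) * precisionForm f x v

/-! ### The assumptions -/

/-- (A1): `K` is a (Borel) bounded integrable function with integral `1`, vanishing at infinity. -/
structure A1 (K : EuclideanSpace ℝ (Fin d) → ℝ) : Prop where
  measurable : Measurable K
  bounded : ∃ C : ℝ, ∀ z, |K z| ≤ C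
  integrable : Integrable K
  integral_eq_one : ∫ z, K z = 1
  tendsto_zero : Tendsto K (cocompact (EuclideanSpace ℝ (Fin d))) (𝓝 0)

/-- (A2): for every `u`, `t ↦ ∫ e^{⟨u, y⟩} f(t, y) dy` is (finite,) bounded, and continuous
at `x`. -/
structure A2 (f : EuclideanSpace ℝ (Fin d) → EuclideanSpace ℝ (Fin q) → ℝ)
    (x : EuclideanSpace ℝ (Fin d)) : Prop where
  integrable : ∀ (u : EuclideanSpace ℝ (Fin q)) (t : EuclideanSpace ℝ (Fin d)),
    Integrable fun y => Real.exp (inner ℝ u y) * f t y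
  bounded : ∀ u : EuclideanSpace ℝ (Fin q), ∃ C : ℝ, ∀ t : EuclideanSpace ℝ (Fin d),
    ∫ y, Real.exp (inner ℝ u y) * f t y ≤ C
  continuousAt : ∀ u : EuclideanSpace ℝ (Fin q),
    ContinuousAt (fun t => ∫ y, Real.exp (inner ℝ u y) * f t y) x

/-- (A3): `t ↦ ∫ ⟨u, y⟩² f(t, y) dy` and `t ↦ ∫ ⟨u, y⟩ f(t, y) dy` are continuous at `x` for
every `u`, and `g(x) ≠ 0`. -/
structure A3 (f : EuclideanSpace ℝ (Fin d) → EuclideanSpace ℝ (Fin q) → ℝ)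
    (x : EuclideanSpace ℝ (Fin d)) : Prop where
  continuousAt_sq : ∀ u : EuclideanSpace ℝ (Fin q),
    ContinuousAt (fun t => ∫ y, (inner ℝ u y) ^ 2 * f t y) x
  continuousAt_one : ∀ u : EuclideanSpace ℝ (Fin q),
    ContinuousAt (fun t => ∫ y, inner ℝ u y * f t y) x
  marginal_ne_zero : marginal f x ≠ 0

/-- (A4): `v_n → ∞` and `n h_n^d / v_n² → ∞` (in dimension `d`). -/
structure A4 (d : ℕ) (h v : ℕ → ℝ) : Prop where
  tendsto_v : Tendsto v atTop atTop
  tendsto_speed : Tendsto (fun n : ℕ => (n : ℝ) * h n ^ d / v n ^ 2) atTop atTop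

/-- `φ` is `p` times differentiable on the whole space, and its differential of order `p` is
bounded on the whole space and continuous at `x`. -/
structure SmoothOfOrder {F : Type*} [NormedAddCommGroup F] [NormedSpace ℝ F]
    (p : ℕ) (φ : EuclideanSpace ℝ (Fin d) → F) (x : EuclideanSpace ℝ (Fin d)) : Prop where
  differentiable : ∀ k < p, Differentiable ℝ (iteratedFDeriv ℝ k φ)
  bounded : ∃ C : ℝ, ∀ t, ‖iteratedFDeriv ℝ p φ t‖ ≤ C
  continuousAt : ContinuousAt (iteratedFDeriv ℝ p φ) x

/-- (A5) for a given integer `p`. In `moment_eq_zero` the integral is over the `j`-th coordinate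
alone, the other coordinates being fixed at (almost) arbitrary values. -/
structure A5 (p : ℕ) (K : EuclideanSpace ℝ (Fin d) → ℝ) (h v : ℕ → ℝ)
    (f : EuclideanSpace ℝ (Fin d) → EuclideanSpace ℝ (Fin q) → ℝ)
    (x : EuclideanSpace ℝ (Fin d)) : Prop where
  two_le : 2 ≤ p
  moment_eq_zero : ∀ s : ℕ, 1 ≤ s → s ≤ p - 1 → ∀ j : Fin d,
    ∀ᵐ y : EuclideanSpace ℝ (Fin d),
      ∫ t : ℝ, t ^ s * K (WithLp.toLp 2 (Function.update y.ofLp j t)) = 0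
  moment_integrable : ∀ j : Fin d,
    Integrable fun y : EuclideanSpace ℝ (Fin d) => |y j ^ p * K y|
  tendsto_bias : Tendsto (fun n => v n * h n ^ p) atTop (𝓝 0)
  smooth_firstMoment : SmoothOfOrder p (firstMoment f) x
  smooth_marginal : SmoothOfOrder p (marginal f) x

end Model

end SemiRecursive

end

noncomputable section

namespace SemiRecursive

/-! ### Regular variation -/

/-- Uniform convergence theorem for slowly varying functions, in additive form. -/
theorem tendsto_sub_of_slowlyVarying {k : ℝ → ℝ} (hk : Measurable k)
    (hlim : ∀ s, Tendsto (fun y => k (y + s) - k y) atTop (𝓝 0))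
    {y s : ℕ → ℝ} (hy : Tendsto y atTop atTop) (hs : ∀ᶠ n in atTop, s n ∈ Set.Icc (0 : ℝ) 1) :
    Tendsto (fun n => k (y n + s n) - k (y n)) atTop (𝓝 0) := by
  have key : ∀ z : ℕ → ℝ, Tendsto z atTop atTop → ∀ ε : ℝ, 0 < ε → ∀ᶠ n in atTop,
      volume {t | t ∈ Set.Icc (0 : ℝ) 3 ∧ ε ≤ |k (z n + t) - k (z n)|} < ENNReal.ofReal (1 / 4) := by
    intro z hz ε hε
    have h1 : TendstoInMeasure (volume.restrict (Set.Icc (0 : ℝ) 3))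
        (fun n t => k (z n + t) - k (z n)) atTop (fun _ => 0) := by
      apply tendstoInMeasure_of_tendsto_ae
      · intro n
        exact ((hk.comp (measurable_const.add measurable_id)).sub_const _).aestronglyMeasurable
      · exact ae_of_all _ fun t => (hlim t).comp hz
    have h2 := h1 (ENNReal.ofReal ε) (by simpa using hε)
    have h3 := h2.eventually (gt_mem_nhds (show (0 : ENNReal) < ENNReal.ofReal (1 / 4) by simp))
    filter_upwards [h3] with n hn
    refine lt_of_le_of_lt ?_ hn
    rw [Measure.restrict_apply']
    · apply measure_mono
      rintro t ⟨ht, ht'⟩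
      refine ⟨?_, ht⟩
      simp only [Set.mem_ofPred_eq, edist_zero_right]
      rw [← ofReal_norm]
      exact ENNReal.ofReal_le_ofReal ht'
    · exact measurableSet_Icc
  have hys : Tendsto (fun n => y n + s n) atTop atTop := by
    refine tendsto_atTop_mono' _ ?_ hy
    filter_upwards [hs] with n hn
    linarith [hn.1]
  rw [Metric.tendsto_nhds]
  intro ε hε
  filter_upwards [key y hy (ε / 2) (by positivity), key _ hys (ε / 2) (by positivity), hs]
    with n h1 h2 hsn
  set B1 := {t | t ∈ Set.Icc (0 : ℝ) 3 ∧ ε / 2 ≤ |k (y n + t) - k (y n)|}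
  set B2 := {t | t ∈ Set.Icc (0 : ℝ) 3 ∧ ε / 2 ≤ |k (y n + s n + t) - k (y n + s n)|}
  have h3 : volume ((fun t => t + -s n) ⁻¹' B2) = volume B2 := measure_preimage_add_right _ _ _
  have h4 : ∃ t ∈ Set.Icc (1 : ℝ) 3, t ∉ B1 ∧ t + -s n ∉ B2 := by
    by_contra! hcon
    have hsub : Set.Icc (1 : ℝ) 3 ⊆ B1 ∪ (fun t => t + -s n) ⁻¹' B2 := by
      intro t ht
      by_cases h : t ∈ B1
      · exact Or.inl h
      · exact Or.inr (hcon t ht h)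
    have h5 := (measure_mono hsub).trans (measure_union_le (μ := volume) _ _)
    rw [h3, Real.volume_Icc] at h5
    have h6 := h5.trans (add_le_add h1.le h2.le)
    rw [← ENNReal.ofReal_add (by norm_num) (by norm_num),
      ENNReal.ofReal_le_ofReal_iff (by norm_num)] at h6
    norm_num at h6
  obtain ⟨t, ht, ht1, ht2⟩ := h4
  have e1 : |k (y n + t) - k (y n)| < ε / 2 := by
    by_contra! h
    exact ht1 ⟨⟨by linarith [ht.1], ht.2⟩, h⟩
  have e2 : |k (y n + s n + (t + -s n)) - k (y n + s n)| < ε / 2 := by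
    by_contra! h
    exact ht2 ⟨⟨by linarith [ht.1, hsn.2], by linarith [ht.2, hsn.1]⟩, h⟩
  rw [show y n + s n + (t + -s n) = y n + t by ring] at e2
  rw [Real.dist_eq, sub_zero]
  rw [abs_lt] at e1 e2 ⊢
  constructor <;> linarith [e1.1, e1.2, e2.1, e2.2]

/-- Uniform convergence theorem for regularly varying functions, along sequences. -/
theorem RegularlyVaryingFun.tendsto_ratio_seq {u : ℝ → ℝ} {ρ : ℝ} (hu : RegularlyVaryingFun u ρ)
    {x c : ℕ → ℝ} {c₀ : ℝ} (hx : Tendsto x atTop atTop) (hc : Tendsto c atTop (𝓝 c₀))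
    (hc₀ : 0 < c₀) :
    Tendsto (fun n => u (c n * x n) / u (x n)) atTop (𝓝 (c₀ ^ ρ)) := by
  set k : ℝ → ℝ := fun y => Real.log (u (Real.exp y)) - ρ * y with hkdef
  have hk : Measurable k := by
    have := hu.measurable
    fun_prop
  have hlim : ∀ s, Tendsto (fun y => k (y + s) - k y) atTop (𝓝 0) := by
    intro s
    have h1 := (hu.tendsto_ratio (Real.exp s) (Real.exp_pos s)).comp Real.tendsto_exp_atTop
    have h2 := h1.log (by positivity)
    have h3 := h2.sub_const (ρ * s)
    rw [Real.log_rpow (Real.exp_pos s), Real.log_exp, sub_self] at h3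
    refine h3.congr fun y => ?_
    simp only [Function.comp, hkdef]
    rw [Real.log_div (hu.pos _ (by positivity)).ne' (hu.pos _ (by positivity)).ne',
      ← Real.exp_add, add_comm s y]
    ring
  have hlx : Tendsto (fun n => Real.log (x n)) atTop atTop := Real.tendsto_log_atTop.comp hx
  have hlc : Tendsto (fun n => Real.log (c n)) atTop (𝓝 (Real.log c₀)) := hc.log hc₀.ne'
  have hy : Tendsto (fun n => Real.log (x n) + (Real.log c₀ - 1 / 2)) atTop atTop :=
    tendsto_atTop_add_const_right _ _ hlx
  have h1 := tendsto_sub_of_slowlyVarying hk hlim hy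
    (s := fun n => Real.log (c n) - Real.log c₀ + 1 / 2) (by
      have : Tendsto (fun n => Real.log (c n) - Real.log c₀ + 1 / 2) atTop (𝓝 (1 / 2)) := by
        have h0 := (hlc.sub_const (Real.log c₀)).add_const (1 / 2 : ℝ)
        rwa [sub_self, zero_add] at h0
      exact this.eventually (Icc_mem_nhds (by norm_num) (by norm_num)))
  have h2 := (hlim (Real.log c₀ - 1 / 2)).comp hlx
  have h3 := ((h1.add h2).add (hlc.const_mul ρ)).rexp
  rw [zero_add, zero_add, mul_comm ρ, Real.exp_mul, Real.exp_log hc₀] at h3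
  refine h3.congr' ?_
  filter_upwards [hx.eventually_gt_atTop 0, hc.eventually (lt_mem_nhds hc₀)] with n hxn hcn
  simp only [Function.comp, hkdef]
  have e1 : Real.exp (Real.log (x n) + (Real.log c₀ - 1 / 2) +
      (Real.log (c n) - Real.log c₀ + 1 / 2)) = c n * x n := by
    rw [show Real.log (x n) + (Real.log c₀ - 1 / 2) + (Real.log (c n) - Real.log c₀ + 1 / 2)
      = Real.log (c n) + Real.log (x n) by ring, Real.exp_add, Real.exp_log hcn, Real.exp_log hxn]
  rw [e1, Real.exp_log hxn]
  have p1 := hu.pos _ (mul_pos hcn hxn)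
  have p2 := hu.pos _ hxn
  rw [← Real.exp_log (div_pos p1 p2), Real.log_div p1.ne' p2.ne']
  congr 1
  ring

/-- If `m n / n → c > 0`, then `h (m n) / h n → c ^ ρ`. -/
theorem RegularlyVaryingSeq.tendsto_ratio {h : ℕ → ℝ} {ρ : ℝ} (hreg : RegularlyVaryingSeq h ρ)
    {m : ℕ → ℕ} {c : ℝ} (hc : 0 < c)
    (hm : Tendsto (fun n : ℕ => (m n : ℝ) / n) atTop (𝓝 c)) :
    Tendsto (fun n => h (m n) / h n) atTop (𝓝 (c ^ ρ)) := by
  obtain ⟨u, hu, hhu⟩ := hreg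
  refine (hu.tendsto_ratio_seq tendsto_natCast_atTop_atTop hm hc).congr' ?_
  filter_upwards [eventually_ge_atTop 1, hm.eventually (lt_mem_nhds hc)] with n hn hmn
  have hn' : (0 : ℝ) < n := by exact_mod_cast hn
  have hm1 : 1 ≤ m n := by
    have : (0 : ℝ) < m n := by
      by_contra! hcon
      exact absurd hmn (not_lt.2 (div_nonpos_of_nonpos_of_nonneg hcon hn'.le))
    exact_mod_cast this
  rw [hhu n hn, hhu (m n) hm1, div_mul_cancel₀ _ hn'.ne']

/-- Dyadic recursion: `y n ≤ θ y (n / 2) + B` with `θ < 1` forces boundedness. -/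
theorem exists_bound_of_dyadic {y : ℕ → ℝ} {θ B : ℝ} (hθ0 : 0 ≤ θ) (hθ : θ < 1)
    (hrec : ∀ᶠ n in atTop, y n ≤ θ * y (n / 2) + B) : ∃ D : ℝ, 0 < D ∧ ∀ n, y n ≤ D := by
  obtain ⟨N, hN⟩ := eventually_atTop.1 hrec
  set D := (∑ i ∈ Finset.range (N + 1), |y i|) + |B| / (1 - θ) + 1 with hD
  have h1 : 0 < 1 - θ := by linarith
  have hS : 0 ≤ ∑ i ∈ Finset.range (N + 1), |y i| := Finset.sum_nonneg fun _ _ => abs_nonneg _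
  have hB : 0 ≤ |B| / (1 - θ) := by positivity
  refine ⟨D, by positivity, fun n => ?_⟩
  induction n using Nat.strong_induction_on with
  | _ n ih =>
    by_cases hn : n < N + 1
    · have := Finset.single_le_sum (f := fun i => |y i|) (fun i _ => abs_nonneg (y i))
        (Finset.mem_range.2 hn)
      have h2 := le_abs_self (y n)
      linarith
    · have h2 := hN n (by omega)
      have h3 := ih (n / 2) (by omega)
      have h4 : θ * y (n / 2) ≤ θ * D := mul_le_mul_of_nonneg_left h3 hθ0
      have h5 : |B| ≤ (1 - θ) * D := by
        have : |B| = (1 - θ) * (|B| / (1 - θ)) := by field_simp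
        rw [this]
        exact mul_le_mul_of_nonneg_left (by linarith) h1.le
      linarith [le_abs_self B]

theorem tendsto_half_div : Tendsto (fun n : ℕ => ((n / 2 : ℕ) : ℝ) / n) atTop (𝓝 (1 / 2)) := by
  have h1 := (tendsto_nat_floor_mul_div_atTop (R := ℝ) (a := 1 / 2) (by norm_num)).comp
    tendsto_natCast_atTop_atTop
  refine h1.congr fun n => ?_
  rw [← Nat.floor_div_eq_div (K := ℝ)]
  rw [show (n : ℝ) / (2 : ℕ) = 1 / 2 * n by push_cast; ring]
  rfl

section Seq

variable {h : ℕ → ℝ} {a : ℝ}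

theorem RegularlyVaryingSeq.exists_rpow_mul_le (hreg : RegularlyVaryingSeq h (-a))
    (hh : ∀ n, 1 ≤ n → 0 < h n) {b : ℝ} (hb : b < a) :
    ∃ D : ℝ, 0 < D ∧ ∀ n : ℕ, 1 ≤ n → (n : ℝ) ^ b * h n ≤ D := by
  have h1 := hreg.tendsto_ratio (m := fun n => n / 2) (by norm_num) tendsto_half_div
  have h2 := ((tendsto_half_div.rpow_const (p := b) (Or.inl (by norm_num))).mul h1)
  rw [← Real.rpow_add (by norm_num)] at h2
  have hgt : (1 : ℝ) < (1 / 2) ^ (b + -a) := by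
    rw [one_div, Real.inv_rpow (by norm_num), ← Real.rpow_neg (by norm_num)]
    exact Real.one_lt_rpow (by norm_num) (by linarith)
  obtain ⟨l, hl1, hl2⟩ := exists_between hgt
  have h3 := h2.eventually (lt_mem_nhds hl2)
  obtain ⟨D, hD, hbd⟩ := exists_bound_of_dyadic (y := fun n => (n : ℝ) ^ b * h n) (θ := l⁻¹)
    (B := 0) (by positivity) (inv_lt_one_of_one_lt₀ hl1) (by
      filter_upwards [h3, eventually_ge_atTop 2] with n hn hn2
      have hpos : 0 < h n := hh n (by omega)
      have hn' : (0 : ℝ) < n := by exact_mod_cast (show 0 < n by omega)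
      rw [Real.div_rpow (by positivity) hn'.le, div_mul_div_comm, lt_div_iff₀ (by positivity)] at hn
      rw [add_zero, inv_mul_eq_div, le_div_iff₀ (by positivity)]
      linarith)
  exact ⟨D, hD, fun n _ => hbd n⟩

theorem RegularlyVaryingSeq.tendsto_zero (hreg : RegularlyVaryingSeq h (-a))
    (hh : ∀ n, 1 ≤ n → 0 < h n) (ha : 0 < a) : Tendsto h atTop (𝓝 0) := by
  obtain ⟨D, hD, hbd⟩ := hreg.exists_rpow_mul_le hh (b := a / 2) (by linarith)
  have h1 : Tendsto (fun n : ℕ => D * (n : ℝ) ^ (-(a / 2))) atTop (𝓝 0) := by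
    simpa using ((tendsto_rpow_neg_atTop (show 0 < a / 2 by linarith)).comp
      tendsto_natCast_atTop_atTop).const_mul D
  refine tendsto_of_tendsto_of_tendsto_of_le_of_le' tendsto_const_nhds h1 ?_ ?_
  · filter_upwards [eventually_ge_atTop 1] with n hn using (hh n hn).le
  · filter_upwards [eventually_ge_atTop 1] with n hn
    have hn' : (0 : ℝ) < n := by exact_mod_cast hn
    rw [Real.rpow_neg hn'.le, ← div_eq_mul_inv, le_div_iff₀ (by positivity)]
    linarith [hbd n hn]

theorem integral_ceil_mul (F : ℕ → ℝ) {n : ℕ} (hn : 1 ≤ n) :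
    ∫ s in (0 : ℝ)..1, F ⌈s * n⌉₊ = (n : ℝ)⁻¹ * ∑ i ∈ Finset.Icc 1 n, F i := by
  have hn' : (0 : ℝ) < n := by exact_mod_cast hn
  have hceil : ∀ k : ℕ, ∀ s ∈ Set.Ioc ((k : ℝ) / n) (((k + 1 : ℕ) : ℝ) / n),
      F ⌈s * n⌉₊ = F (k + 1) := by
    intro k s hs
    have : ⌈s * n⌉₊ = k + 1 := by
      rw [Nat.ceil_eq_iff (by omega)]
      refine ⟨?_, (le_div_iff₀ hn').1 hs.2⟩
      simpa using (div_lt_iff₀ hn').1 hs.1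
    rw [this]
  have hle : ∀ k : ℕ, (k : ℝ) / n ≤ ((k + 1 : ℕ) : ℝ) / n := fun k => by
    gcongr; simp
  have h1 := intervalIntegral.sum_integral_adjacent_intervals (f := fun s : ℝ => F ⌈s * n⌉₊)
    (μ := volume) (a := fun k : ℕ => (k : ℝ) / n) (n := n) (by
      intro k _
      rw [intervalIntegrable_iff_integrableOn_Ioc_of_le (hle k)]
      exact (integrableOn_const (C := F (k + 1)) (by simp)).congr_fun
        (fun s hs => (hceil k s hs).symm) measurableSet_Ioc)
  simp only [Nat.cast_zero, zero_div, div_self hn'.ne'] at h1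
  have hshift : ∑ i ∈ Finset.Icc 1 n, (n : ℝ)⁻¹ * F i
      = ∑ i ∈ Finset.Ico 0 n, (n : ℝ)⁻¹ * F (i + 1) := by
    rw [Finset.sum_Ico_add' (fun i => (n : ℝ)⁻¹ * F i), zero_add, Finset.Ico_add_one_right_eq_Icc]
  rw [← h1, Finset.mul_sum, hshift, Finset.range_eq_Ico]
  refine Finset.sum_congr rfl fun k _ => ?_
  rw [intervalIntegral.integral_of_le (hle k), setIntegral_congr_fun measurableSet_Ioc (hceil k),
    setIntegral_const, smul_eq_mul, Measure.real, Real.volume_Ioc, ENNReal.toReal_ofReal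
      (sub_nonneg.2 (hle k))]
  push_cast
  field_simp
  ring

theorem RegularlyVaryingSeq.tendsto_mean_ratio_pow (hreg : RegularlyVaryingSeq h (-a))
    (hh : ∀ n, 1 ≤ n → 0 < h n) (ha : 0 < a) {C : ℝ}
    (hsup : ∀ n i : ℕ, 1 ≤ i → i ≤ n → h n / h i ≤ C) (d : ℕ) :
    Tendsto (fun n : ℕ => (n : ℝ)⁻¹ * ∑ i ∈ Finset.Icc 1 n, (h n / h i) ^ d) atTop
      (𝓝 (1 / (1 + a * d))) := by
  have hlim : Tendsto (fun n : ℕ => ∫ s in (0 : ℝ)..1, (h n / h ⌈s * n⌉₊) ^ d) atTop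
      (𝓝 (∫ s in (0 : ℝ)..1, s ^ (a * d))) := by
    apply intervalIntegral.tendsto_integral_filter_of_dominated_convergence (fun _ => C ^ d)
    · refine Eventually.of_forall fun n => ?_
      have : Measurable fun s : ℝ => (h n / h ⌈s * n⌉₊) ^ d :=
        (measurable_of_countable (fun i : ℕ => (h n / h i) ^ d)).comp
          (Nat.measurable_ceil.comp (measurable_id.mul_const _))
      exact this.aestronglyMeasurable
    · filter_upwards [eventually_ge_atTop 1] with n hn
      refine ae_of_all _ fun s hs => ?_
      rw [Set.uIoc_of_le zero_le_one] at hs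
      have hn' : (0 : ℝ) < n := by exact_mod_cast hn
      have h1 : 1 ≤ ⌈s * n⌉₊ := Nat.one_le_ceil_iff.2 (mul_pos hs.1 hn')
      have h2 : ⌈s * n⌉₊ ≤ n := Nat.ceil_le.2 (by nlinarith [hs.2])
      have h3 : 0 ≤ h n / h ⌈s * n⌉₊ := (div_pos (hh _ hn) (hh _ h1)).le
      rw [Real.norm_of_nonneg (by positivity)]
      exact pow_le_pow_left₀ h3 (hsup _ _ h1 h2) _
    · exact intervalIntegrable_const
    · refine ae_of_all _ fun s hs => ?_
      rw [Set.uIoc_of_le zero_le_one] at hs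
      have h1 := hreg.tendsto_ratio (m := fun n => ⌈s * n⌉₊) hs.1
        ((tendsto_nat_ceil_mul_div_atTop (R := ℝ) hs.1.le).comp tendsto_natCast_atTop_atTop)
      have h2 := (h1.inv₀ (Real.rpow_pos_of_pos hs.1 _).ne').pow d
      rw [← Real.rpow_neg hs.1.le, neg_neg, ← Real.rpow_natCast, ← Real.rpow_mul hs.1.le] at h2
      simpa using h2
  rw [integral_rpow (Or.inl (by have : 0 ≤ a * d := by positivity
                                linarith))] at hlim
  have had : a * d + 1 ≠ 0 := by positivity
  rw [Real.one_rpow, Real.zero_rpow had, sub_zero, add_comm (a * d)] at hlim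
  refine hlim.congr' ?_
  filter_upwards [eventually_ge_atTop 1] with n hn
  exact integral_ceil_mul (fun i => (h n / h i) ^ d) hn

theorem tendsto_mean_zero {τ : ℕ → ℝ} (hτ : Tendsto τ atTop (𝓝 0)) :
    Tendsto (fun n : ℕ => (n : ℝ)⁻¹ * ∑ i ∈ Finset.Icc 1 n, |τ i|) atTop (𝓝 0) := by
  have h1 : Tendsto (fun n => |τ (n + 1)|) atTop (𝓝 0) := by
    simpa using ((tendsto_add_atTop_iff_nat 1).2 hτ).abs
  refine h1.cesaro.congr fun n => ?_
  congr 1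
  rw [Finset.range_eq_Ico, Finset.sum_Ico_add' (fun i => |τ i|)]
  simp [Finset.Ico_add_one_right_eq_Icc]

theorem sum_inv_sqrt_le (n : ℕ) : ∑ i ∈ Finset.Icc 1 n, (√(i : ℝ))⁻¹ ≤ 2 * √n := by
  induction n with
  | zero => simp
  | succ n ih =>
    rw [Finset.sum_Icc_succ_top (by omega)]
    have h1 : (0 : ℝ) < √((n + 1 : ℕ) : ℝ) := by positivity
    have h2 : (0 : ℝ) ≤ √(n : ℝ) := by positivity
    have h3 : √((n + 1 : ℕ) : ℝ) ^ 2 = n + 1 := by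
      rw [Real.sq_sqrt (by positivity)]; push_cast; ring
    have h4 : √(n : ℝ) ^ 2 = n := Real.sq_sqrt (by positivity)
    have h5 : (√((n + 1 : ℕ) : ℝ))⁻¹ ≤ 2 * √((n + 1 : ℕ) : ℝ) - 2 * √(n : ℝ) := by
      rw [inv_le_iff_one_le_mul₀ h1]
      nlinarith [sq_nonneg (√((n + 1 : ℕ) : ℝ) - √(n : ℝ))]
    linarith

theorem RegularlyVaryingSeq.tendsto_mean_bias (hreg : RegularlyVaryingSeq h (-a))
    (hh : ∀ n, 1 ≤ n → 0 < h n) (ha : 0 < a) {C : ℝ}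
    (hsup : ∀ n i : ℕ, 1 ≤ i → i ≤ n → h n / h i ≤ C) {v : ℕ → ℝ} (hv : ∀ n, 1 ≤ n → 0 < v n)
    {p : ℕ} (hbias : Tendsto (fun n => v n * h n ^ p) atTop (𝓝 0))
    (hvn : Tendsto (fun n : ℕ => v n ^ 2 / n) atTop (𝓝 0)) :
    Tendsto (fun n : ℕ => v n * ((n : ℝ)⁻¹ * ∑ i ∈ Finset.Icc 1 n, h i ^ p)) atTop (𝓝 0) := by
  have hT : ∀ n : ℕ, 0 ≤ ∑ i ∈ Finset.Icc 1 n, h i ^ p := fun n =>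
    Finset.sum_nonneg fun i hi => (pow_pos (hh i (Finset.mem_Icc.1 hi).1) p).le
  have hC : 0 ≤ C := (div_pos (hh 1 le_rfl) (hh 1 le_rfl)).le.trans (hsup 1 1 le_rfl le_rfl)
  rcases lt_or_ge (a * p) 1 with hap | hap
  · have h1 := hreg.tendsto_ratio (m := fun n => n / 2) (by norm_num) tendsto_half_div
    have h2 := h1.pow p
    have h3 := tendsto_half_div.mul h2
    have hlt : (1 / 2 : ℝ) * ((1 / 2) ^ (-a)) ^ p < 1 := by
      rw [← Real.rpow_natCast, ← Real.rpow_mul (by norm_num), one_div,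
        Real.inv_rpow (by norm_num), ← Real.rpow_neg (by norm_num)]
      have : (2 : ℝ) ^ (-(-a * p)) < 2 ^ (1 : ℝ) :=
        Real.rpow_lt_rpow_of_exponent_lt (by norm_num) (by linarith)
      rw [Real.rpow_one] at this
      linarith
    obtain ⟨θ, hθ1, hθ2⟩ := exists_between hlt
    set B := (((1 / 2 : ℝ) ^ (-a)) ^ p + 1)
    obtain ⟨D, hD, hbd⟩ := exists_bound_of_dyadic
      (y := fun n => (∑ i ∈ Finset.Icc 1 n, h i ^ p) / (n * h n ^ p)) (θ := θ) (B := C ^ p * B)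
      ((by positivity : (0 : ℝ) ≤ 1 / 2 * ((1 / 2) ^ (-a)) ^ p).trans hθ1.le) hθ2 (by
        filter_upwards [h3.eventually (gt_mem_nhds hθ1),
          h2.eventually (gt_mem_nhds (lt_add_one _)), eventually_ge_atTop 2] with n e1 e2 hn
        set m := n / 2 with hm
        have hm1 : 1 ≤ m := by omega
        have hmn : m ≤ n := by omega
        have hn' : (0 : ℝ) < n := by exact_mod_cast (show 0 < n by omega)
        have hm' : (0 : ℝ) < m := by exact_mod_cast hm1
        have hpn := hh n (by omega)
        have hpm := hh m hm1
        have hsplit : ∑ i ∈ Finset.Icc 1 n, h i ^ p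
            ≤ ∑ i ∈ Finset.Icc 1 m, h i ^ p + n * (C ^ p * h m ^ p) := by
          rw [← Finset.Ico_add_one_right_eq_Icc, ← Finset.Ico_add_one_right_eq_Icc,
            ← Finset.sum_Ico_consecutive _ (show 1 ≤ m + 1 by omega)
              (show m + 1 ≤ n + 1 by omega)]
          gcongr
          refine (Finset.sum_le_card_nsmul _ _ (C ^ p * h m ^ p) fun i hi => ?_).trans ?_
          · obtain ⟨hi1, hi2⟩ := Finset.mem_Ico.1 hi
            rw [← mul_pow]
            refine pow_le_pow_left₀ (hh i (by omega)).le ?_ _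
            exact (div_le_iff₀ hpm).1 (hsup i m hm1 (by omega))
          · rw [nsmul_eq_mul, Nat.card_Ico]
            gcongr
            omega
        have hy : 0 ≤ (∑ i ∈ Finset.Icc 1 m, h i ^ p) / (m * h m ^ p) :=
          div_nonneg (hT m) (by positivity)
        calc (∑ i ∈ Finset.Icc 1 n, h i ^ p) / (n * h n ^ p)
            ≤ (∑ i ∈ Finset.Icc 1 m, h i ^ p + n * (C ^ p * h m ^ p)) / (n * h n ^ p) := by
              gcongr
          _ = ((m : ℝ) / n * (h m / h n) ^ p)
                * ((∑ i ∈ Finset.Icc 1 m, h i ^ p) / (m * h m ^ p))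
              + C ^ p * (h m / h n) ^ p := by
              rw [div_pow]
              field_simp
          _ ≤ _ := by gcongr)
    have h4 : Tendsto (fun n => D * (v n * h n ^ p)) atTop (𝓝 0) := by
      simpa using hbias.const_mul D
    refine tendsto_of_tendsto_of_tendsto_of_le_of_le' tendsto_const_nhds h4 ?_ ?_
    · filter_upwards [eventually_ge_atTop 1] with n hn
      exact mul_nonneg (hv n hn).le (mul_nonneg (by positivity) (hT n))
    · filter_upwards [eventually_ge_atTop 1] with n hn
      have hn' : (0 : ℝ) < n := by exact_mod_cast hn
      have hpn := hh n hn
      have hvn' := hv n hn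
      have e1 := hbd n
      rw [div_le_iff₀ (by positivity)] at e1
      calc v n * ((n : ℝ)⁻¹ * ∑ i ∈ Finset.Icc 1 n, h i ^ p)
          ≤ v n * ((n : ℝ)⁻¹ * (D * (n * h n ^ p))) := by gcongr
        _ = D * (v n * h n ^ p) := by field_simp
  · obtain ⟨D, hD, hbd⟩ := hreg.exists_rpow_mul_le hh (b := a / 2) (by linarith)
    have hsum : ∀ n : ℕ, ∑ i ∈ Finset.Icc 1 n, h i ^ p ≤ D ^ p * (2 * √n) := by
      intro n
      refine le_trans ?_ (mul_le_mul_of_nonneg_left (sum_inv_sqrt_le n) (by positivity))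
      rw [Finset.mul_sum]
      refine Finset.sum_le_sum fun i hi => ?_
      have hi1 := (Finset.mem_Icc.1 hi).1
      have hi' : (1 : ℝ) ≤ i := by exact_mod_cast hi1
      have e1 := pow_le_pow_left₀ (mul_nonneg (by positivity) (hh i hi1).le) (hbd i hi1) p
      rw [mul_pow, ← Real.rpow_natCast ((i : ℝ) ^ (a / 2)), ← Real.rpow_mul (by positivity)] at e1
      have e2 : √(i : ℝ) ≤ (i : ℝ) ^ (a / 2 * p) := by
        rw [Real.sqrt_eq_rpow]
        exact Real.rpow_le_rpow_of_exponent_le hi' (by linarith)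
      rw [← div_eq_mul_inv, le_div_iff₀ (by positivity), mul_comm]
      exact (mul_le_mul_of_nonneg_right e2 (pow_pos (hh i hi1) p).le).trans e1
    have h4 : Tendsto (fun n : ℕ => 2 * D ^ p * √(v n ^ 2 / n)) atTop (𝓝 0) := by
      simpa using hvn.sqrt.const_mul (2 * D ^ p)
    refine tendsto_of_tendsto_of_tendsto_of_le_of_le' tendsto_const_nhds h4 ?_ ?_
    · filter_upwards [eventually_ge_atTop 1] with n hn
      exact mul_nonneg (hv n hn).le (mul_nonneg (by positivity) (hT n))
    · filter_upwards [eventually_ge_atTop 1] with n hn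
      have hn' : (0 : ℝ) < n := by exact_mod_cast hn
      have hvn' := hv n hn
      rw [Real.sqrt_div (by positivity), Real.sqrt_sq hvn'.le]
      calc v n * ((n : ℝ)⁻¹ * ∑ i ∈ Finset.Icc 1 n, h i ^ p)
          ≤ v n * ((n : ℝ)⁻¹ * (D ^ p * (2 * √n))) := by
            gcongr
            exact hsum n
        _ = 2 * D ^ p * (v n / √n) := by
            have e : (n : ℝ) = √n * √n := (Real.mul_self_sqrt hn'.le).symm
            have e' : √(n : ℝ) ≠ 0 := by positivity
            rw [show (n : ℝ)⁻¹ = (√n * √n)⁻¹ by rw [← e]]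
            field_simp

end Seq

/-! ### Taylor expansion and bias -/

/-- Taylor's formula on `[0, 1]` for a chain of derivatives `ψ 0, ψ 1, …, ψ p`. -/
theorem abs_sub_taylor_le (p : ℕ) {ψ : ℕ → ℝ → ℝ} {C : ℝ} (hC : 0 ≤ C)
    (hder : ∀ k < p, ∀ s, HasDerivAt (ψ k) (ψ (k + 1) s) s)
    (hbd : ∀ s ∈ Set.Icc (0 : ℝ) 1, |ψ p s| ≤ C) :
    ∀ s ∈ Set.Icc (0 : ℝ) 1, |ψ 0 s - ∑ k ∈ Finset.range p, ψ k 0 * s ^ k / k.factorial| ≤ C := by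
  induction p generalizing ψ with
  | zero => simpa using hbd
  | succ p ih =>
    have h1 := ih (ψ := fun k => ψ (k + 1)) (fun k hk s => hder (k + 1) (by omega) s) hbd
    set r : ℝ → ℝ := fun s => ψ 0 s - ∑ k ∈ Finset.range (p + 1), ψ k 0 * s ^ k / k.factorial
    have hr : ∀ s, HasDerivAt r
        (ψ 1 s - ∑ k ∈ Finset.range p, ψ (k + 1) 0 * s ^ k / k.factorial) s := by
      intro s
      refine (hder 0 (by omega) s).sub ?_
      have h2 : HasDerivAt (fun s : ℝ => ∑ k ∈ Finset.range (p + 1), ψ k 0 * s ^ k / k.factorial)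
          (∑ k ∈ Finset.range (p + 1), ψ k 0 * (k * s ^ (k - 1)) / k.factorial) s :=
        HasDerivAt.fun_sum fun k _ => ((hasDerivAt_pow k s).const_mul _).div_const _
      refine h2.congr_deriv ?_
      rw [Finset.sum_range_succ']
      simp only [Nat.cast_zero, zero_mul, mul_zero, zero_div, add_zero]
      refine Finset.sum_congr rfl fun k _ => ?_
      rw [Nat.factorial_succ]
      push_cast
      have : (k.factorial : ℝ) ≠ 0 := by positivity
      field_simp
    have hr0 : r 0 = 0 := by
      simp only [r]
      rw [Finset.sum_range_succ']
      simp
    intro s hs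
    have h3 := Convex.norm_image_sub_le_of_norm_hasDerivWithin_le (f := r) (s := Set.Icc (0 : ℝ) 1)
      (fun t _ => (hr t).hasDerivWithinAt) h1 (convex_Icc 0 1) (Set.left_mem_Icc.2 zero_le_one) hs
    rw [hr0, sub_zero, sub_zero, Real.norm_eq_abs, Real.norm_of_nonneg hs.1] at h3
    exact h3.trans (mul_le_of_le_one_right hC hs.2)

section

variable {d : ℕ}

variable {F : Type*} [NormedAddCommGroup F] [NormedSpace ℝ F]

theorem SmoothOfOrder.abs_sub_taylor_le {p : ℕ} {φ : EuclideanSpace ℝ (Fin d) → F}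
    {x : EuclideanSpace ℝ (Fin d)} (hφ : SmoothOfOrder p φ x) (ℓ : F →L[ℝ] ℝ) :
    ∃ C : ℝ, 0 ≤ C ∧ ∀ w : EuclideanSpace ℝ (Fin d),
      |ℓ (φ (x + w)) - ∑ k ∈ Finset.range p,
        ℓ (iteratedFDeriv ℝ k φ x (fun _ => w)) / k.factorial| ≤ C * ‖w‖ ^ p := by
  obtain ⟨C, hC⟩ := hφ.bounded
  have hC0 : 0 ≤ C := (norm_nonneg _).trans (hC x)
  refine ⟨‖ℓ‖ * C, by positivity, fun w => ?_⟩
  have h1 := SemiRecursive.abs_sub_taylor_le p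
    (ψ := fun k s => ℓ (iteratedFDeriv ℝ k φ (x + s • w) (fun _ => w))) (C := ‖ℓ‖ * C * ‖w‖ ^ p)
    (by positivity) (by
      intro k hk s
      have e1 : HasDerivAt (fun s : ℝ => x + s • w) w s := by
        simpa using ((hasDerivAt_id s).smul_const w).const_add x
      have e2 := ((hφ.differentiable k hk (x + s • w)).hasFDerivAt).comp_hasDerivAt s e1
      have e3 := (ContinuousMultilinearMap.apply ℝ
        (fun _ : Fin k => EuclideanSpace ℝ (Fin d)) F (fun _ => w)).hasFDerivAt.comp_hasDerivAt s e2
      exact ℓ.hasFDerivAt.comp_hasDerivAt s e3) (by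
      intro s _
      refine (ℓ.le_opNorm _).trans ?_
      rw [mul_assoc]
      gcongr
      refine ((iteratedFDeriv ℝ p φ (x + s • w)).le_opNorm _).trans ?_
      simp only [Finset.prod_const, Finset.card_univ, Fintype.card_fin]
      gcongr
      exact hC _) 1 (by simp)
  simpa using h1

theorem norm_le_sum_abs (z : EuclideanSpace ℝ (Fin d)) : ‖z‖ ≤ ∑ j, |z j| := by
  conv_lhs => rw [← (EuclideanSpace.basisFun (Fin d) ℝ).sum_repr z]
  refine (norm_sum_le _ _).trans (Finset.sum_le_sum fun j _ => ?_)
  rw [norm_smul]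
  simp

/-- Fubini along one coordinate. -/
theorem integral_eq_zero_of_coordinate (j : Fin d) {F : EuclideanSpace ℝ (Fin d) → ℝ}
    (hF : Integrable F)
    (h0 : ∀ᵐ y : EuclideanSpace ℝ (Fin d),
      ∫ t : ℝ, F (WithLp.toLp 2 (Function.update y.ofLp j t)) = 0) :
    ∫ z, F z = 0 := by
  obtain ⟨n, rfl⟩ : ∃ n, d = n + 1 := ⟨d - 1, by have := j.pos; omega⟩
  have hp1 := PiLp.volume_preserving_toLp (Fin (n + 1))
  have hp2 := (volume_preserving_piFinSuccAbove (fun _ : Fin (n + 1) => ℝ) j).symm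
  have hp := hp1.comp hp2
  have hemb : MeasurableEmbedding (WithLp.toLp 2 ∘
      (MeasurableEquiv.piFinSuccAbove (fun _ : Fin (n + 1) => ℝ) j).symm) :=
    (MeasurableEquiv.toLp 2 (Fin (n + 1) → ℝ)).measurableEmbedding.comp
      (MeasurableEquiv.measurableEmbedding _)
  have hval : ∀ (t : ℝ) (y : Fin n → ℝ),
      (MeasurableEquiv.piFinSuccAbove (fun _ : Fin (n + 1) => ℝ) j).symm (t, y)
        = j.insertNth t y := fun t y => rfl
  have h1 : ∀ᵐ w : ℝ × (Fin n → ℝ),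
      ∫ t : ℝ, F (WithLp.toLp 2 (j.insertNth (α := fun _ => ℝ) t w.2)) = 0 := by
    filter_upwards [hp.quasiMeasurePreserving.ae h0] with w hw
    rw [← hw]
    congr 1
    ext t
    congr 2
    simp only [Function.comp]
    rw [hval w.1 w.2, Fin.update_insertNth]
  have h2 : ∀ᵐ y : Fin n → ℝ,
      ∫ t : ℝ, F (WithLp.toLp 2 (j.insertNth (α := fun _ => ℝ) t y)) = 0 :=
    (Measure.ae_ae_of_ae_prod h1).exists.choose_spec
  have hint : Integrable (F ∘ (WithLp.toLp 2 ∘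
      (MeasurableEquiv.piFinSuccAbove (fun _ : Fin (n + 1) => ℝ) j).symm)) :=
    (hp.integrable_comp_emb hemb).2 hF
  rw [← hp.integral_comp hemb]
  rw [Measure.volume_eq_prod] at hint ⊢
  refine (integral_prod_symm _ hint).trans ?_
  refine integral_eq_zero_of_ae ?_
  filter_upwards [h2] with y hy
  exact hy

variable {K : EuclideanSpace ℝ (Fin d) → ℝ}

theorem integrable_norm_pow_mul (hK : Integrable K) {p : ℕ} (hp : 1 ≤ p)
    (hmom : ∀ j : Fin d, Integrable fun y : EuclideanSpace ℝ (Fin d) => |y j ^ p * K y|)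
    {k : ℕ} (hk : k ≤ p) : Integrable fun z => ‖z‖ ^ k * K z := by
  obtain ⟨n, rfl⟩ : ∃ n, p = n + 1 := ⟨p - 1, by omega⟩
  have hS : Integrable fun z : EuclideanSpace ℝ (Fin d) =>
      |K z| + (d : ℝ) ^ n * ∑ j, |z j ^ (n + 1) * K z| :=
    hK.abs.add ((integrable_finsetSum _ fun j _ => hmom j).const_mul _)
  refine hS.mono' ((by fun_prop : Continuous fun z : EuclideanSpace ℝ (Fin d) => ‖z‖ ^ k)
    |>.aestronglyMeasurable.mul hK.aestronglyMeasurable) (ae_of_all _ fun z => ?_)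
  rw [norm_mul, norm_pow, norm_norm, Real.norm_eq_abs]
  have h1 : ‖z‖ ^ k ≤ 1 + ‖z‖ ^ (n + 1) := by
    rcases le_total ‖z‖ 1 with h | h
    · have := pow_le_one₀ (n := k) (norm_nonneg z) h
      have : 0 ≤ ‖z‖ ^ (n + 1) := by positivity
      linarith
    · linarith [pow_le_pow_right₀ h hk]
  have h2 : ‖z‖ ^ (n + 1) ≤ (d : ℝ) ^ n * ∑ j, |z j| ^ (n + 1) := by
    refine (pow_le_pow_left₀ (norm_nonneg z) (norm_le_sum_abs z) _).trans ?_
    rcases Nat.eq_zero_or_pos d with rfl | hd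
    · simp
    have h3 := pow_sum_div_card_le_sum_pow (s := Finset.univ) (f := fun j => |z j|)
      (fun j _ => abs_nonneg _) n
    rw [Finset.card_univ, Fintype.card_fin, div_le_iff₀ (by positivity)] at h3
    linarith
  calc ‖z‖ ^ k * |K z| ≤ (1 + (d : ℝ) ^ n * ∑ j, |z j| ^ (n + 1)) * |K z| := by
        gcongr
        exact h1.trans (by linarith)
    _ = _ := by
        simp only [abs_mul, abs_pow]
        rw [← Finset.sum_mul]
        ring

theorem integral_multilinear_mul_eq_zero (hK : Integrable K) {p : ℕ}
    (hmom0 : ∀ s : ℕ, 1 ≤ s → s ≤ p - 1 → ∀ j : Fin d, ∀ᵐ y : EuclideanSpace ℝ (Fin d),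
      ∫ t : ℝ, t ^ s * K (WithLp.toLp 2 (Function.update y.ofLp j t)) = 0)
    (hmom : ∀ j : Fin d, Integrable fun y : EuclideanSpace ℝ (Fin d) => |y j ^ p * K y|)
    {k : ℕ} (hk1 : 1 ≤ k) (hkp : k < p)
    (M : ContinuousMultilinearMap ℝ (fun _ : Fin k => EuclideanSpace ℝ (Fin d)) ℝ) :
    ∫ z, M (fun _ => z) * K z = 0 := by
  set b := EuclideanSpace.basisFun (Fin d) ℝ
  have hexp : ∀ z : EuclideanSpace ℝ (Fin d), M (fun _ => z) =
      ∑ J : Fin k → Fin d, (∏ i, z (J i)) * M (fun i => b (J i)) := by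
    intro z
    conv_lhs => rw [← b.sum_repr z]
    rw [M.map_sum (fun _ j => b.repr z j • b j)]
    refine Finset.sum_congr rfl fun J _ => ?_
    rw [M.map_smul_univ]
    simp [b]
  have hint : ∀ J : Fin k → Fin d, Integrable fun z => (∏ i, z (J i)) * K z := by
    intro J
    have hc : Continuous fun z : EuclideanSpace ℝ (Fin d) => ∏ i, z (J i) := by fun_prop
    refine (integrable_norm_pow_mul hK (by omega) hmom hkp.le).norm.mono'
      (hc.aestronglyMeasurable.mul hK.aestronglyMeasurable) (ae_of_all _ fun z => ?_)
    rw [norm_mul, norm_mul, norm_pow, norm_norm, norm_prod]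
    gcongr
    refine (Finset.prod_le_prod (fun i _ => norm_nonneg _)
      fun i _ => PiLp.norm_apply_le z (J i)).trans ?_
    simp
  have hzero : ∀ J : Fin k → Fin d, ∫ z, (∏ i, z (J i)) * K z = 0 := by
    intro J
    set j := J ⟨0, hk1⟩ with hj
    refine integral_eq_zero_of_coordinate j (hint J) ?_
    set s := (Finset.univ.filter fun i => J i = j).card with hs
    have hs1 : 1 ≤ s := Finset.card_pos.2 ⟨⟨0, hk1⟩, by simp [hj]⟩
    have hs2 : s ≤ p - 1 := by
      have := Finset.card_filter_le (Finset.univ : Finset (Fin k)) fun i => J i = j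
      simp only [Finset.card_univ, Fintype.card_fin] at this
      omega
    filter_upwards [hmom0 s hs1 hs2 j] with y hy
    have hprod : ∀ t : ℝ, (∏ i, (Function.update y.ofLp j t) (J i))
        = t ^ s * ∏ i ∈ Finset.univ.filter (fun i => ¬ J i = j), y (J i) := by
      intro t
      rw [← Finset.prod_filter_mul_prod_filter_not Finset.univ (fun i => J i = j)]
      congr 1
      · rw [hs, ← Finset.prod_const]
        refine Finset.prod_congr rfl fun i hi => ?_
        rw [(Finset.mem_filter.1 hi).2, Function.update_self]
      · refine Finset.prod_congr rfl fun i hi => ?_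
        rw [Function.update_of_ne (Finset.mem_filter.1 hi).2]
    simp only [hprod]
    calc ∫ t : ℝ, t ^ s * (∏ i ∈ Finset.univ.filter (fun i => ¬ J i = j), y (J i)) *
          K (WithLp.toLp 2 (Function.update y.ofLp j t))
        = ∫ t : ℝ, (∏ i ∈ Finset.univ.filter (fun i => ¬ J i = j), y (J i)) *
          (t ^ s * K (WithLp.toLp 2 (Function.update y.ofLp j t))) := by
          congr 1
          ext t
          ring
      _ = 0 := by rw [integral_const_mul, hy, mul_zero]
  simp only [hexp, Finset.sum_mul]
  rw [integral_finsetSum _ fun J _ => by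
    have := (hint J).mul_const (M fun i => b (J i))
    exact this.congr (ae_of_all _ fun z => by ring)]
  refine Finset.sum_eq_zero fun J _ => ?_
  calc ∫ z, (∏ i, z.ofLp (J i)) * M (fun i => b (J i)) * K z
      = ∫ z, M (fun i => b (J i)) * ((∏ i, z (J i)) * K z) := by
        congr 1
        ext z
        ring
    _ = 0 := by rw [integral_const_mul, hzero J, mul_zero]

/-- The bias of a kernel of order `p`. -/
theorem exists_bias_bound (hK : A1 K) {p : ℕ} (hp : 1 ≤ p)
    (hmom0 : ∀ s : ℕ, 1 ≤ s → s ≤ p - 1 → ∀ j : Fin d, ∀ᵐ y : EuclideanSpace ℝ (Fin d),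
      ∫ t : ℝ, t ^ s * K (WithLp.toLp 2 (Function.update y.ofLp j t)) = 0)
    (hmom : ∀ j : Fin d, Integrable fun y : EuclideanSpace ℝ (Fin d) => |y j ^ p * K y|)
    {φ : EuclideanSpace ℝ (Fin d) → F} {x : EuclideanSpace ℝ (Fin d)}
    (hφ : SmoothOfOrder p φ x) (ℓ : F →L[ℝ] ℝ) :
    ∃ C : ℝ, ∀ h : ℝ, 0 < h → |(∫ z, K z * ℓ (φ (x - h • z))) - ℓ (φ x)| ≤ C * h ^ p := by
  obtain ⟨C, hC0, hC⟩ := hφ.abs_sub_taylor_le ℓ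
  refine ⟨C * ∫ z, ‖‖z‖ ^ p * K z‖, fun h hh => ?_⟩
  have hφc : Continuous φ := by
    have h0 := hφ.differentiable 0 (by omega)
    have h1 : Differentiable ℝ φ := by
      have h2 : φ = fun y => iteratedFDeriv ℝ 0 φ y (fun _ => 0) := by
        ext y; simp
      rw [h2]
      exact fun y => ((ContinuousMultilinearMap.apply ℝ
        (fun _ : Fin 0 => EuclideanSpace ℝ (Fin d)) F (fun _ => 0)).differentiableAt).comp y (h0 y)
    exact h1.continuous
  set T : EuclideanSpace ℝ (Fin d) → ℝ := fun z => ∑ k ∈ Finset.range p,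
    ((-h) ^ k / k.factorial) * (ℓ (iteratedFDeriv ℝ k φ x (fun _ => z)) * K z) with hT
  have hTint : ∀ k ∈ Finset.range p, Integrable fun z =>
      ((-h) ^ k / k.factorial) * (ℓ (iteratedFDeriv ℝ k φ x (fun _ => z)) * K z) := by
    intro k hk
    refine Integrable.const_mul ?_ _
    have hc : Continuous fun z : EuclideanSpace ℝ (Fin d) =>
      ℓ (iteratedFDeriv ℝ k φ x (fun _ => z)) :=
      ℓ.continuous.comp
        ((iteratedFDeriv ℝ k φ x).cont.comp (continuous_pi fun _ => continuous_id))
    refine ((integrable_norm_pow_mul hK.integrable hp hmom (Finset.mem_range.1 hk).le).norm.const_mul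
      (‖ℓ‖ * ‖iteratedFDeriv ℝ k φ x‖)).mono' (hc.aestronglyMeasurable.mul
        hK.integrable.aestronglyMeasurable) (ae_of_all _ fun z => ?_)
    rw [norm_mul, norm_mul, norm_pow, norm_norm, ← mul_assoc]
    gcongr
    refine (ℓ.le_opNorm _).trans ?_
    rw [mul_assoc]
    gcongr
    refine ((iteratedFDeriv ℝ k φ x).le_opNorm _).trans ?_
    simp
  have hTI : ∫ z, T z = ℓ (φ x) := by
    rw [hT, integral_finsetSum _ hTint]
    rw [Finset.sum_eq_single_of_mem 0 (Finset.mem_range.2 (by omega))]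
    · rw [integral_const_mul]
      simp only [iteratedFDeriv_zero_apply]
      rw [integral_const_mul, hK.integral_eq_one]
      simp
    · intro k hk hk0
      rw [integral_const_mul]
      exact mul_eq_zero_of_right _ (integral_multilinear_mul_eq_zero hK.integrable hmom0 hmom
        (by omega) (Finset.mem_range.1 hk)
        (ℓ.compContinuousMultilinearMap (iteratedFDeriv ℝ k φ x)))
  have hrem : ∀ z, ‖K z * ℓ (φ (x - h • z)) - T z‖ ≤ C * h ^ p * ‖‖z‖ ^ p * K z‖ := by
    intro z
    have h1 := hC ((-h) • z)
    have h2 : T z = K z * ∑ k ∈ Finset.range p,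
        ℓ (iteratedFDeriv ℝ k φ x (fun _ => (-h) • z)) / k.factorial := by
      rw [hT, Finset.mul_sum]
      refine Finset.sum_congr rfl fun k _ => ?_
      rw [show (fun _ : Fin k => (-h) • z) = fun i => (fun _ : Fin k => -h) i • (fun _ => z) i
        from rfl, ContinuousMultilinearMap.map_smul_univ]
      simp
      ring
    rw [h2, ← mul_sub, norm_mul, norm_mul, norm_pow, norm_norm]
    rw [show x - h • z = x + (-h) • z by module]
    rw [norm_smul, norm_neg, Real.norm_of_nonneg hh.le, mul_pow] at h1
    calc ‖K z‖ * _ ≤ ‖K z‖ * (C * (h ^ p * ‖z‖ ^ p)) := by gcongr; exact h1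
      _ = _ := by ring
  have hRint := ((integrable_norm_pow_mul hK.integrable hp hmom le_rfl).norm.const_mul (C * h ^ p))
  have hdiff : Integrable fun z => K z * ℓ (φ (x - h • z)) - T z := by
    refine hRint.mono' ?_ (ae_of_all _ hrem)
    have hcomp : Continuous fun z => ℓ (φ (x - h • z)) := by fun_prop
    exact (hK.integrable.aestronglyMeasurable.mul hcomp.aestronglyMeasurable).sub
      (integrable_finsetSum _ hTint).aestronglyMeasurable
  have hTint' : Integrable T := integrable_finsetSum _ hTint
  have hmain : Integrable fun z => K z * ℓ (φ (x - h • z)) :=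
    (hdiff.add hTint').congr (ae_of_all _ fun z => by simp)
  rw [← hTI, ← integral_sub hmain hTint', ← Real.norm_eq_abs]
  refine (norm_integral_le_of_norm_le hRint (ae_of_all _ hrem)).trans (le_of_eq ?_)
  rw [integral_const_mul]
  ring

end

/-! ### Exponential bounds and large deviations -/

section Exponential

variable {Ω : Type*} [MeasurableSpace Ω] {P : Measure Ω} [IsProbabilityMeasure P] {ν : ℕ → ℝ}

theorem eventually_const_mul_exp_le (hν : Tendsto ν atTop atTop) {b b' : ℝ} (hb : b < b') (c : ℝ) :
    ∀ᶠ n in atTop, c * Real.exp (-(ν n * b')) ≤ Real.exp (-(ν n * b)) := by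
  have h1 : Tendsto (fun n => Real.exp (ν n * (b' - b))) atTop atTop :=
    Real.tendsto_exp_atTop.comp (hν.atTop_mul_const (by linarith))
  filter_upwards [h1.eventually_ge_atTop c] with n hn
  calc c * Real.exp (-(ν n * b')) ≤ Real.exp (ν n * (b' - b)) * Real.exp (-(ν n * b')) := by gcongr
    _ = Real.exp (-(ν n * b)) := by
      rw [← Real.exp_add]
      ring_nf

theorem limsup_log_le (hν : Tendsto ν atTop atTop) {E : ℕ → Set Ω} {β : EReal}
    (h : ∀ b : ℝ, (b : EReal) < β → ∀ᶠ n in atTop, P.real (E n) ≤ Real.exp (-(ν n * b))) :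
    limsup (fun n => (((ν n)⁻¹ : ℝ) : EReal) * ENNReal.log (P (E n))) atTop ≤ -β := by
  rw [EReal.le_neg]
  refine EReal.ge_of_forall_gt_iff_ge.1 fun b hb => ?_
  rw [EReal.le_neg]
  refine limsup_le_of_le (by isBoundedDefault) ?_
  filter_upwards [h b hb, hν.eventually_gt_atTop 0] with n hn hn0
  have h1 : P (E n) ≤ ENNReal.ofReal (Real.exp (-(ν n * b))) := by
    rw [← ofReal_measureReal (μ := P) (s := E n)]
    exact ENNReal.ofReal_le_ofReal hn
  have h2 := ENNReal.log_monotone h1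
  rw [ENNReal.log_ofReal_of_pos (Real.exp_pos _), Real.log_exp] at h2
  refine (mul_le_mul_of_nonneg_left h2 (by exact_mod_cast (inv_pos.2 hn0).le)).trans ?_
  rw [← EReal.coe_mul, ← EReal.coe_neg, EReal.coe_le_coe_iff]
  rw [mul_neg, ← mul_assoc, inv_mul_cancel₀ hn0.ne', one_mul]

theorem le_liminf_log (hν : Tendsto ν atTop atTop) {E : ℕ → Set Ω} {β : ℝ}
    (h : ∀ b : ℝ, β < b → ∀ᶠ n in atTop, Real.exp (-(ν n * b)) ≤ P.real (E n)) :
    -(β : EReal) ≤ liminf (fun n => (((ν n)⁻¹ : ℝ) : EReal) * ENNReal.log (P (E n))) atTop := by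
  rw [EReal.neg_le]
  refine EReal.le_of_forall_lt_iff_le.1 fun b hb => ?_
  rw [EReal.neg_le]
  refine le_liminf_of_le (by isBoundedDefault) ?_
  filter_upwards [h b (by exact_mod_cast hb), hν.eventually_gt_atTop 0] with n hn hn0
  have h1 : ENNReal.ofReal (Real.exp (-(ν n * b))) ≤ P (E n) := by
    rw [← ofReal_measureReal (μ := P) (s := E n)]
    exact ENNReal.ofReal_le_ofReal hn
  have h2 := ENNReal.log_monotone h1
  rw [ENNReal.log_ofReal_of_pos (Real.exp_pos _), Real.log_exp] at h2
  refine le_trans ?_ (mul_le_mul_of_nonneg_left h2 (by exact_mod_cast (inv_pos.2 hn0).le))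
  rw [← EReal.coe_mul, ← EReal.coe_neg, EReal.coe_le_coe_iff]
  rw [mul_neg, ← mul_assoc, inv_mul_cancel₀ hn0.ne', one_mul]

variable {E : Type*} [NormedAddCommGroup E] [InnerProductSpace ℝ E]

/-- Finitely many unit directions detect vectors of norm at least `ε`. -/
theorem exists_finset_directions [FiniteDimensional ℝ E] {ε : ℝ} (hε : 0 < ε) :
    ∃ s : Finset E, (∀ u ∈ s, ‖u‖ = 1) ∧ ∀ y : E, ε ≤ ‖y‖ → ∃ u ∈ s, ε / 2 ≤ inner ℝ u y := by
  obtain ⟨s, hs1, hs2⟩ := (isCompact_sphere (0 : E) 1).elim_nhds_subcover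
    (fun u => {w | 1 / 2 < inner ℝ u w}) (by
      intro u hu
      refine (isOpen_lt continuous_const (by fun_prop)).mem_nhds ?_
      rw [mem_sphere_zero_iff_norm] at hu
      change 1 / 2 < inner ℝ u u
      rw [real_inner_self_eq_norm_sq, hu]
      norm_num)
  refine ⟨s, fun u hu => mem_sphere_zero_iff_norm.1 (hs1 u hu), fun y hy => ?_⟩
  have hy0 : 0 < ‖y‖ := hε.trans_le hy
  have h1 : ‖y‖⁻¹ • y ∈ Metric.sphere (0 : E) 1 := by
    rw [mem_sphere_zero_iff_norm, norm_smul, norm_inv, norm_norm, inv_mul_cancel₀ hy0.ne']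
  have h2 := hs2 h1
  simp only [Set.mem_iUnion, exists_prop] at h2
  obtain ⟨u, hu, hlt⟩ := h2
  change 1 / 2 < inner ℝ u (‖y‖⁻¹ • y) at hlt
  refine ⟨u, hu, ?_⟩
  rw [inner_smul_right, inv_mul_eq_div, lt_div_iff₀ hy0] at hlt
  linarith

variable {A : ℕ → Ω → E} {T : E →L[ℝ] E}

section Laplace

variable (hν : Tendsto ν atTop atTop)
  (hint : ∀ u : E, ∀ᶠ n in atTop, Integrable (fun ω => Real.exp (ν n * inner ℝ u (A n ω))) P)
  (hΛ : ∀ u : E, Tendsto (fun n => (ν n)⁻¹ *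
    Real.log (∫ ω, Real.exp (ν n * inner ℝ u (A n ω)) ∂P)) atTop (𝓝 (inner ℝ u (T u) / 2)))

include hν hint hΛ

theorem eventually_laplace_le (u : E) {c : ℝ} (hc : inner ℝ u (T u) / 2 < c) :
    ∀ᶠ n in atTop, ∫ ω, Real.exp (ν n * inner ℝ u (A n ω)) ∂P ≤ Real.exp (ν n * c) := by
  filter_upwards [hint u, (hΛ u).eventually (gt_mem_nhds hc), hν.eventually_gt_atTop 0]
    with n h1 h2 h3
  rw [inv_mul_eq_div, div_lt_iff₀ h3, mul_comm c] at h2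
  exact ((Real.log_lt_iff_lt_exp (integral_exp_pos h1)).1 h2).le

theorem eventually_le_laplace (u : E) {c : ℝ} (hc : c < inner ℝ u (T u) / 2) :
    ∀ᶠ n in atTop, Real.exp (ν n * c) ≤ ∫ ω, Real.exp (ν n * inner ℝ u (A n ω)) ∂P := by
  filter_upwards [hint u, (hΛ u).eventually (lt_mem_nhds hc), hν.eventually_gt_atTop 0]
    with n h1 h2 h3
  rw [inv_mul_eq_div, lt_div_iff₀ h3, mul_comm c] at h2
  exact ((Real.lt_log_iff_exp_lt (integral_exp_pos h1)).1 h2).le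

/-- Chernoff bound on half-spaces. -/
theorem eventually_halfspace_le (u : E) {c b : ℝ} (hb : b < c - inner ℝ u (T u) / 2) :
    ∀ᶠ n in atTop, P.real {ω | c ≤ inner ℝ u (A n ω)} ≤ Real.exp (-(ν n * b)) := by
  filter_upwards [hint u, eventually_laplace_le hν hint hΛ u (c := c - b) (by linarith),
    hν.eventually_gt_atTop 0] with n h1 h2 h3
  refine (measure_ge_le_exp_mul_mgf (X := fun ω => inner ℝ u (A n ω)) c h3.le h1).trans ?_
  refine (mul_le_mul_of_nonneg_left h2 (Real.exp_pos _).le).trans (le_of_eq ?_)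
  rw [← Real.exp_add]
  ring_nf

/-- Lower bound on balls, by exponential tilting. -/
theorem eventually_le_ball [FiniteDimensional ℝ E] [MeasurableSpace E] [BorelSpace E]
    (hA : ∀ n, Measurable (A n)) (hT : ∀ u v : E, inner ℝ u (T v) = inner ℝ (T u) v)
    (θ : E) {ε b : ℝ} (hε : 0 < ε) (hb : inner ℝ θ (T θ) / 2 < b) :
    ∀ᶠ n in atTop, Real.exp (-(ν n * b)) ≤ P.real {ω | ‖A n ω - T θ‖ < ε} := by
  set Q := inner ℝ θ (T θ) / 2 with hQ
  obtain ⟨ε', hε', hεε, hbε⟩ : ∃ ε' > 0, ε' ≤ ε ∧ Q + ‖θ‖ * ε' < b := by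
    refine ⟨min ε ((b - Q) / (2 * (‖θ‖ + 1))), lt_min hε (div_pos (by linarith) (by positivity)),
      min_le_left _ _, ?_⟩
    have h1 : ‖θ‖ * min ε ((b - Q) / (2 * (‖θ‖ + 1)))
        ≤ (‖θ‖ + 1) * ((b - Q) / (2 * (‖θ‖ + 1))) := by
      gcongr
      · linarith
      · exact min_le_right _ _
    have h2 : (‖θ‖ + 1) * ((b - Q) / (2 * (‖θ‖ + 1))) = (b - Q) / 2 := by field_simp
    linarith
  obtain ⟨s, hs1, hs2⟩ := exists_finset_directions (E := E) hε'
  obtain ⟨η, hη0, hη⟩ : ∃ η > 0, η * ‖T‖ < ε' / 2 := by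
    refine ⟨ε' / (4 * (‖T‖ + 1)), by positivity, ?_⟩
    rw [div_mul_eq_mul_div, div_lt_iff₀ (by positivity)]
    nlinarith [norm_nonneg T]
  set ζ := min (η * ε' / 8) ((b - Q - ‖θ‖ * ε') / 2) with hζ
  have hζ0 : 0 < ζ := lt_min (by positivity) (by linarith)
  have hζ1 : ζ ≤ η * ε' / 8 := min_le_left _ _
  have hζ2 : ζ ≤ (b - Q - ‖θ‖ * ε') / 2 := min_le_right _ _
  have htail : ∀ u ∈ s, ∀ᶠ n in atTop,
      (∫ ω, Real.exp (ν n * inner ℝ (θ + η • u) (A n ω)) ∂P) ≤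
        Real.exp (ν n * (Q - 2 * ζ + η * inner ℝ u (T θ) + η * (ε' / 2))) := by
    intro u hu
    refine eventually_laplace_le hν hint hΛ _ ?_
    have h1 : inner ℝ (θ + η • u) (T (θ + η • u)) =
        2 * Q + 2 * (η * inner ℝ u (T θ)) + η ^ 2 * inner ℝ u (T u) := by
      simp only [map_add, map_smul, inner_add_left, inner_add_right, real_inner_smul_left,
        real_inner_smul_right]
      rw [hT θ u, real_inner_comm u (T θ), hQ]
      ring
    have h2 : inner ℝ u (T u) ≤ ‖T‖ := by
      refine (real_inner_le_norm _ _).trans ?_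
      have := T.le_opNorm u
      rw [hs1 u hu] at this ⊢
      linarith
    have h3 : η ^ 2 * inner ℝ u (T u) ≤ η * (ε' / 2) := by
      rw [pow_two, mul_assoc]
      gcongr
      exact (mul_le_mul_of_nonneg_left h2 hη0.le).trans hη.le
    rw [h1]
    nlinarith
  have hall := (Finset.eventually_all s).2 htail
  have hintall : ∀ᶠ n in atTop, ∀ u ∈ s,
      Integrable (fun ω => Real.exp (ν n * inner ℝ (θ + η • u) (A n ω))) P :=
    (Finset.eventually_all s).2 fun u _ => hint _
  filter_upwards [hall, hintall, hint θ, hν.eventually_gt_atTop 0,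
    eventually_le_laplace hν hint hΛ θ (c := Q - ζ / 2) (by linarith),
    eventually_const_mul_exp_le hν (b := ζ) (b' := 2 * ζ) (by linarith) s.card,
    eventually_const_mul_exp_le hν (b := ζ / 2) (b' := ζ) (by linarith) 2]
    with n htl hti hi hn hlow hcard htwo
  set f : Ω → ℝ := fun ω => Real.exp (ν n * inner ℝ θ (A n ω)) with hf
  set G := {ω | ‖A n ω - T θ‖ < ε'} with hG
  have hGm : MeasurableSet G :=
    measurableSet_lt ((hA n).sub_const _).norm measurable_const
  have hsplit := integral_add_compl hGm hi
  have hG1 : ∫ ω in G, f ω ∂P ≤ Real.exp (ν n * (2 * Q + ‖θ‖ * ε')) * P.real G := by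
    refine (setIntegral_mono_on hi.integrableOn (integrableOn_const (by simp)) hGm
      (g := fun _ => Real.exp (ν n * (2 * Q + ‖θ‖ * ε'))) fun ω hω => ?_).trans (le_of_eq ?_)
    · refine Real.exp_le_exp.2 (mul_le_mul_of_nonneg_left ?_ hn.le)
      have h1 : inner ℝ θ (A n ω) = 2 * Q + inner ℝ θ (A n ω - T θ) := by
        rw [inner_sub_right, hQ]; ring
      rw [h1]
      have h2 := real_inner_le_norm θ (A n ω - T θ)
      have h3 : ‖θ‖ * ‖A n ω - T θ‖ ≤ ‖θ‖ * ε' := by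
        gcongr
        exact le_of_lt hω
      linarith
    · rw [setIntegral_const, smul_eq_mul, mul_comm]
  have hG2 : ∫ ω in Gᶜ, f ω ∂P ≤ s.card * Real.exp (ν n * (Q - 2 * ζ)) := by
    have hterm : ∀ u ∈ s, Integrable (fun ω => Real.exp (ν n * inner ℝ (θ + η • u) (A n ω)) *
        Real.exp (-(ν n * (η * inner ℝ u (T θ) + η * (ε' / 2))))) P :=
      fun u hu => (hti u hu).mul_const _
    calc ∫ ω in Gᶜ, f ω ∂P
        ≤ ∫ ω in Gᶜ, ∑ u ∈ s, Real.exp (ν n * inner ℝ (θ + η • u) (A n ω)) *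
            Real.exp (-(ν n * (η * inner ℝ u (T θ) + η * (ε' / 2)))) ∂P := by
          refine setIntegral_mono_on hi.integrableOn
            (integrable_finsetSum _ hterm).integrableOn hGm.compl fun ω hω => ?_
          have hω' : ε' ≤ ‖A n ω - T θ‖ := not_lt.1 hω
          obtain ⟨u, hu, hle⟩ := hs2 _ hω'
          refine le_trans ?_ (Finset.single_le_sum (f := fun u =>
            Real.exp (ν n * inner ℝ (θ + η • u) (A n ω)) *
            Real.exp (-(ν n * (η * inner ℝ u (T θ) + η * (ε' / 2))))) (fun _ _ => by positivity) hu)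
          rw [← Real.exp_add]
          refine Real.exp_le_exp.2 ?_
          rw [inner_add_left, real_inner_smul_left, ← sub_eq_add_neg, ← mul_sub]
          refine mul_le_mul_of_nonneg_left ?_ hn.le
          rw [inner_sub_right] at hle
          nlinarith
      _ ≤ ∫ ω, ∑ u ∈ s, Real.exp (ν n * inner ℝ (θ + η • u) (A n ω)) *
            Real.exp (-(ν n * (η * inner ℝ u (T θ) + η * (ε' / 2)))) ∂P :=
          setIntegral_le_integral (integrable_finsetSum _ hterm)
            (ae_of_all _ fun ω => Finset.sum_nonneg fun _ _ => by positivity)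
      _ ≤ ∑ u ∈ s, Real.exp (ν n * (Q - 2 * ζ)) := by
          rw [integral_finsetSum _ hterm]
          refine Finset.sum_le_sum fun u hu => ?_
          rw [integral_mul_const]
          refine (mul_le_mul_of_nonneg_right (htl u hu) (Real.exp_pos _).le).trans (le_of_eq ?_)
          rw [← Real.exp_add]
          ring_nf
      _ = _ := by rw [Finset.sum_const, nsmul_eq_mul]
  have hmono : P.real G ≤ P.real {ω | ‖A n ω - T θ‖ < ε} :=
    measureReal_mono fun ω hω => lt_of_lt_of_le hω hεε
  refine le_trans ?_ hmono
  have e1 : (s.card : ℝ) * Real.exp (ν n * (Q - 2 * ζ)) ≤ Real.exp (ν n * (Q - ζ)) := by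
    have : ∀ c : ℝ, Real.exp (ν n * (Q - c)) = Real.exp (ν n * Q) * Real.exp (-(ν n * c)) := by
      intro c; rw [← Real.exp_add]; ring_nf
    rw [this, this, mul_left_comm]
    gcongr
  have e2 : 2 * Real.exp (ν n * (Q - ζ)) ≤ Real.exp (ν n * (Q - ζ / 2)) := by
    have : ∀ c : ℝ, Real.exp (ν n * (Q - c)) = Real.exp (ν n * Q) * Real.exp (-(ν n * c)) := by
      intro c; rw [← Real.exp_add]; ring_nf
    rw [this, this, mul_left_comm]
    gcongr
  have e3 : Real.exp (ν n * (Q - ζ)) ≤ Real.exp (ν n * (2 * Q + ‖θ‖ * ε')) * P.real G := by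
    change ∫ ω in G, f ω ∂P + ∫ ω in Gᶜ, f ω ∂P = ∫ ω, f ω ∂P at hsplit
    linarith
  rw [← div_le_iff₀' (Real.exp_pos _), ← Real.exp_sub] at e3
  refine le_trans (Real.exp_le_exp.2 ?_) e3
  nlinarith

end Laplace

end Exponential

/-! ### Large deviations of self-normalized sums with a Gaussian limit -/

section Quadratic

variable {E : Type*} [NormedAddCommGroup E] [InnerProductSpace ℝ E] {T R : E →L[ℝ] E}

theorem inner_inverse_pos (hpos : ∀ u : E, u ≠ 0 → 0 < inner ℝ u (T u))
    (hTR : ∀ w, T (R w) = w) {w : E} (hw : w ≠ 0) : 0 < inner ℝ w (R w) := by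
  have h1 : R w ≠ 0 := fun h => hw (by rw [← hTR w, h, map_zero])
  have h2 := hpos (R w) h1
  rwa [hTR, real_inner_comm] at h2

theorem exists_coercive (hpos : ∀ u : E, u ≠ 0 → 0 < inner ℝ u (T u))
    (hT : ∀ u v : E, inner ℝ u (T v) = inner ℝ (T u) v)
    (hTR : ∀ w, T (R w) = w) : ∃ c > 0, ∀ w, c * ‖w‖ ^ 2 ≤ inner ℝ w (R w) := by
  set s : ℝ := 1 / (‖T‖ + 1) with hs
  have hs0 : 0 < s := by positivity
  refine ⟨s, hs0, fun w => ?_⟩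
  have h0 : 0 ≤ inner ℝ (R w - s • w) (T (R w - s • w)) := by
    by_cases h : R w - s • w = 0
    · rw [h]; simp
    · exact (hpos _ h).le
  have h1 : inner ℝ (R w - s • w) (T (R w - s • w)) =
      inner ℝ w (R w) - 2 * s * ‖w‖ ^ 2 + s ^ 2 * inner ℝ w (T w) := by
    rw [map_sub, map_smul, hTR]
    simp only [inner_sub_left, inner_sub_right, real_inner_smul_left, real_inner_smul_right]
    rw [hT (R w) w, hTR, real_inner_self_eq_norm_sq, real_inner_comm w (R w)]
    ring
  have h2 : inner ℝ w (T w) ≤ ‖T‖ * ‖w‖ ^ 2 := by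
    refine (real_inner_le_norm _ _).trans ?_
    rw [pow_two, ← mul_assoc, mul_comm ‖w‖]
    gcongr
    exact T.le_opNorm w
  have h3 : s ^ 2 * inner ℝ w (T w) ≤ s * ‖w‖ ^ 2 := by
    have h4 : s * ‖T‖ ≤ 1 := by
      rw [hs, one_div, inv_mul_le_iff₀ (by positivity)]
      linarith
    calc s ^ 2 * inner ℝ w (T w) ≤ s ^ 2 * (‖T‖ * ‖w‖ ^ 2) := by gcongr
      _ = (s * ‖T‖) * (s * ‖w‖ ^ 2) := by ring
      _ ≤ 1 * (s * ‖w‖ ^ 2) := by gcongr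
      _ = _ := one_mul _
  rw [h1] at h0
  linarith

theorem isCompact_quadratic_level [FiniteDimensional ℝ E] {c : ℝ} (hc : 0 < c)
    (hcoer : ∀ w, c * ‖w‖ ^ 2 ≤ inner ℝ w (R w)) (α : ℝ) :
    IsCompact {w : E | inner ℝ w (R w) ≤ α} := by
  refine Metric.isCompact_of_isClosed_isBounded
    (isClosed_le (by fun_prop) continuous_const) ?_
  refine (Metric.isBounded_closedBall (x := (0 : E)) (r := √(α / c))).subset fun w hw => ?_
  rw [mem_closedBall_zero_iff]
  refine Real.le_sqrt_of_sq_le ?_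
  rw [le_div_iff₀ hc]
  linarith [hcoer w, show inner ℝ w (R w) ≤ α from hw]

end Quadratic

section Ratio

variable {Ω : Type*} [MeasurableSpace Ω] {P : Measure Ω} [IsProbabilityMeasure P] {ν : ℕ → ℝ}
  {E : Type*} [NormedAddCommGroup E] [InnerProductSpace ℝ E]
  {A Z : ℕ → Ω → E} {D : ℕ → Ω → ℝ} {T R : E →L[ℝ] E} {γ : ℝ}
  (hν : Tendsto ν atTop atTop)
  (hint : ∀ u : E, ∀ᶠ n in atTop, Integrable (fun ω => Real.exp (ν n * inner ℝ u (A n ω))) P)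
  (hΛ : ∀ u : E, Tendsto (fun n => (ν n)⁻¹ *
    Real.log (∫ ω, Real.exp (ν n * inner ℝ u (A n ω)) ∂P)) atTop (𝓝 (inner ℝ u (T u) / 2)))
  (hγ : 0 < γ)
  (hD : ∀ δ > 0, ∀ L : ℝ, ∀ᶠ n in atTop, P.real {ω | δ ≤ |D n ω - γ|} ≤ Real.exp (-(ν n * L)))
  (hZ : ∀ n ω, D n ω ≠ 0 → Z n ω = (D n ω)⁻¹ • A n ω)

include hν hint hΛ hγ hD hZ

theorem eventually_ratio_halfspace_le {u : E} (hu : 0 < inner ℝ u (T u)) {ρ b : ℝ} (hρ : 0 < ρ)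
    (hb : b < ρ ^ 2 * γ ^ 2 / (2 * inner ℝ u (T u))) :
    ∀ᶠ n in atTop, P.real {ω | ρ ≤ inner ℝ u (Z n ω)} ≤ Real.exp (-(ν n * b)) := by
  set Q := inner ℝ u (T u) with hQ
  obtain ⟨δ, hδ0, hδγ, hδ⟩ : ∃ δ > 0, δ < γ ∧ b < ρ ^ 2 * (γ - δ) ^ 2 / (2 * Q) := by
    have h1 : Tendsto (fun δ : ℝ => ρ ^ 2 * (γ - δ) ^ 2 / (2 * Q)) (𝓝[>] 0)
        (𝓝 (ρ ^ 2 * (γ - 0) ^ 2 / (2 * Q))) :=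
      ((by fun_prop : Continuous fun δ : ℝ => ρ ^ 2 * (γ - δ) ^ 2 / (2 * Q)).tendsto 0).mono_left
        nhdsWithin_le_nhds
    rw [sub_zero] at h1
    obtain ⟨δ, h2, h3, h4⟩ := ((h1.eventually (lt_mem_nhds hb)).and
      ((eventually_mem_nhdsWithin).and (nhdsWithin_le_nhds (gt_mem_nhds hγ)))).exists
    exact ⟨δ, h3, h4, h2⟩
  obtain ⟨b', hb', hb'2⟩ := exists_between hδ
  set c := ρ * (γ - δ) with hc
  have hc0 : 0 < c := mul_pos hρ (by linarith)
  have hrate : b' < (c / Q) * c - inner ℝ ((c / Q) • u) (T ((c / Q) • u)) / 2 := by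
    rw [map_smul, real_inner_smul_left, real_inner_smul_right, ← hQ]
    have h1 : (c / Q) * c - c / Q * (c / Q * Q) / 2 = ρ ^ 2 * (γ - δ) ^ 2 / (2 * Q) := by
      rw [hc]; field_simp; ring
    rw [h1]; exact hb'2
  filter_upwards [eventually_halfspace_le hν hint hΛ ((c / Q) • u) hrate, hD δ hδ0 b',
    eventually_const_mul_exp_le hν hb' 2] with n h1 h2 h3
  have hsub : {ω | ρ ≤ inner ℝ u (Z n ω)} ⊆
      {ω | (c / Q) * c ≤ inner ℝ ((c / Q) • u) (A n ω)} ∪ {ω | δ ≤ |D n ω - γ|} := by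
    intro ω hω
    by_cases hd : δ ≤ |D n ω - γ|
    · exact Or.inr hd
    · left
      have h4 := (abs_lt.1 (not_le.1 hd)).1
      have hDpos : 0 < D n ω := by linarith
      have h5 : ρ ≤ inner ℝ u (Z n ω) := hω
      rw [hZ n ω hDpos.ne', real_inner_smul_right, inv_mul_eq_div, le_div_iff₀ hDpos] at h5
      change (c / Q) * c ≤ inner ℝ ((c / Q) • u) (A n ω)
      rw [real_inner_smul_left]
      refine mul_le_mul_of_nonneg_left ?_ (by positivity)
      refine le_trans ?_ h5
      exact mul_le_mul_of_nonneg_left (by linarith) hρ.le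
  refine (measureReal_mono hsub).trans ((measureReal_union_le _ _).trans ?_)
  linarith

theorem eventually_ratio_le [FiniteDimensional ℝ E]
    (hpos : ∀ u : E, u ≠ 0 → 0 < inner ℝ u (T u))
    (hT : ∀ u v : E, inner ℝ u (T v) = inner ℝ (T u) v) (hTR : ∀ w, T (R w) = w)
    {V : Set E} {b b' : ℝ} (hb : b < b') (hV : ∀ w ∈ V, b' ≤ γ ^ 2 / 2 * inner ℝ w (R w)) :
    ∀ᶠ n in atTop, P.real {ω | Z n ω ∈ V} ≤ Real.exp (-(ν n * b)) := by
  rcases lt_or_ge b 0 with hb0 | hb0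
  · filter_upwards [hν.eventually_gt_atTop 0] with n hn
    refine measureReal_le_one.trans (Real.one_le_exp ?_)
    nlinarith
  have hb'0 : 0 < b' := hb0.trans_lt hb
  set κ := 2 * b' / γ ^ 2 with hκ
  have hκ0 : 0 < κ := by positivity
  obtain ⟨c, hc, hcoer⟩ := exists_coercive hpos hT hTR
  have hL : IsCompact {w : E | inner ℝ w (R w) = κ} :=
    (isCompact_quadratic_level hc hcoer κ).of_isClosed_subset
      (isClosed_eq (by fun_prop) continuous_const) fun w hw => le_of_eq hw
  obtain ⟨σ, hσ0, hσ1, hσ⟩ : ∃ σ > 0, σ < 1 ∧ b < σ ^ 2 * b' := by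
    have h1 : Tendsto (fun σ : ℝ => σ ^ 2 * b') (𝓝[<] 1) (𝓝 (1 ^ 2 * b')) :=
      ((by fun_prop : Continuous fun σ : ℝ => σ ^ 2 * b').tendsto 1).mono_left nhdsWithin_le_nhds
    rw [one_pow, one_mul] at h1
    obtain ⟨σ, h2, h3, h4⟩ := ((h1.eventually (lt_mem_nhds hb)).and
      ((eventually_mem_nhdsWithin).and (nhdsWithin_le_nhds (lt_mem_nhds zero_lt_one)))).exists
    exact ⟨σ, h4, h3, h2⟩
  obtain ⟨s, hs1, hs2⟩ := hL.elim_nhds_subcover (fun w₀ => {w | σ * κ < inner ℝ (R w₀) w}) (by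
    intro w₀ hw₀
    refine (isOpen_lt continuous_const (by fun_prop)).mem_nhds ?_
    change σ * κ < inner ℝ (R w₀) w₀
    rw [real_inner_comm, show inner ℝ w₀ (R w₀) = κ from hw₀]
    exact mul_lt_of_lt_one_left hκ0 hσ1)
  obtain ⟨b₁, hb₁, hb₁σ⟩ := exists_between hσ
  have hall : ∀ᶠ n in atTop, ∀ w₀ ∈ s,
      P.real {ω | σ * κ ≤ inner ℝ (R w₀) (Z n ω)} ≤ Real.exp (-(ν n * b₁)) := by
    refine (Finset.eventually_all s).2 fun w₀ hw₀ => ?_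
    have hw₀κ : inner ℝ w₀ (R w₀) = κ := hs1 w₀ hw₀
    have hQ : inner ℝ (R w₀) (T (R w₀)) = κ := by rw [hTR, real_inner_comm, hw₀κ]
    refine eventually_ratio_halfspace_le hν hint hΛ hγ hD hZ (by rw [hQ]; exact hκ0)
      (by positivity) ?_
    rw [hQ]
    have : (σ * κ) ^ 2 * γ ^ 2 / (2 * κ) = σ ^ 2 * b' := by
      rw [hκ]; field_simp
    rwa [this]
  filter_upwards [hall, eventually_const_mul_exp_le hν hb₁ s.card] with n h1 h2
  have hsub : {ω | Z n ω ∈ V} ⊆ ⋃ w₀ ∈ s, {ω | σ * κ ≤ inner ℝ (R w₀) (Z n ω)} := by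
    intro ω hω
    set w := Z n ω with hw
    set τ := inner ℝ w (R w) with hτ
    have h3 : κ ≤ τ := by
      rw [hκ, div_le_iff₀ (by positivity)]
      have := hV w hω
      linarith
    have hτ0 : 0 < τ := hκ0.trans_le h3
    have h4 : (√(κ / τ)) • w ∈ {w : E | inner ℝ w (R w) = κ} := by
      change inner ℝ _ (R _) = κ
      rw [map_smul, real_inner_smul_left, real_inner_smul_right, ← hτ, ← mul_assoc,
        Real.mul_self_sqrt (by positivity), div_mul_cancel₀ _ hτ0.ne']
    have h5 := hs2 h4
    simp only [Set.mem_iUnion, exists_prop] at h5 ⊢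
    obtain ⟨w₀, hw₀, hlt⟩ := h5
    refine ⟨w₀, hw₀, ?_⟩
    change σ * κ < inner ℝ (R w₀) ((√(κ / τ)) • w) at hlt
    change σ * κ ≤ inner ℝ (R w₀) w
    rw [real_inner_smul_right] at hlt
    have h6 : √(κ / τ) ≤ 1 := Real.sqrt_le_one.2 ((div_le_one hτ0).2 h3)
    have h7 : 0 ≤ √(κ / τ) := Real.sqrt_nonneg _
    have h8 : 0 < σ * κ := by positivity
    have h9 : 0 < inner ℝ (R w₀) w := by
      by_contra! hneg
      nlinarith
    nlinarith
  refine (measureReal_mono hsub (measure_ne_top _ _)).trans ((measureReal_biUnion_finset_le _ _).trans ?_)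
  refine (Finset.sum_le_card_nsmul s _ _ h1).trans ?_
  rwa [nsmul_eq_mul]

theorem eventually_le_ratio [FiniteDimensional ℝ E] [MeasurableSpace E] [BorelSpace E]
    (hA : ∀ n, Measurable (A n))
    (hT : ∀ u v : E, inner ℝ u (T v) = inner ℝ (T u) v) (hTR : ∀ w, T (R w) = w)
    {U : Set E} (hU : IsOpen U) {z : E} (hz : z ∈ U) {b : ℝ}
    (hb : γ ^ 2 / 2 * inner ℝ z (R z) < b) :
    ∀ᶠ n in atTop, Real.exp (-(ν n * b)) ≤ P.real {ω | Z n ω ∈ U} := by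
  obtain ⟨b', hb', hb'2⟩ := exists_between hb
  set θ := γ • R z with hθ
  have hTθ : T θ = γ • z := by rw [hθ, map_smul, hTR]
  have hQ : inner ℝ θ (T θ) / 2 = γ ^ 2 / 2 * inner ℝ z (R z) := by
    rw [hTθ, hθ, real_inner_smul_left, real_inner_smul_right, real_inner_comm]
    ring
  have hcont : ContinuousAt (fun y : ℝ × E => y.1⁻¹ • y.2) (γ, γ • z) :=
    (continuousAt_fst.inv₀ hγ.ne').smul continuousAt_snd
  have hmem : (fun y : ℝ × E => y.1⁻¹ • y.2) ⁻¹' U ∈ 𝓝 (γ, γ • z) := by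
    refine hcont.preimage_mem_nhds (hU.mem_nhds ?_)
    simpa [smul_smul, inv_mul_cancel₀ hγ.ne'] using hz
  obtain ⟨ε, hε, hball⟩ := Metric.mem_nhds_iff.1 hmem
  set δ := min ε γ with hδ
  have hδ0 : 0 < δ := lt_min hε hγ
  filter_upwards [eventually_le_ball hν hint hΛ hA hT θ hε (b := b') (by rw [hQ]; exact hb'),
    hD δ hδ0 b, eventually_const_mul_exp_le hν hb'2 2] with n h1 h2 h3
  have hsub : {ω | ‖A n ω - T θ‖ < ε} ⊆ {ω | Z n ω ∈ U} ∪ {ω | δ ≤ |D n ω - γ|} := by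
    intro ω hω
    by_cases hd : δ ≤ |D n ω - γ|
    · exact Or.inr hd
    · left
      have h4 := not_le.1 hd
      have h5 : 0 < D n ω := by linarith [(abs_lt.1 h4).1, min_le_right ε γ]
      have h6 : (D n ω, A n ω) ∈ Metric.ball (γ, γ • z) ε := by
        rw [Metric.mem_ball, Prod.dist_eq, max_lt_iff, Real.dist_eq, dist_eq_norm, ← hTθ]
        exact ⟨h4.trans_le (min_le_left _ _), hω⟩
      have h7 : (D n ω)⁻¹ • A n ω ∈ U := hball h6
      rwa [← hZ n ω h5.ne'] at h7
  have h4 := (measureReal_mono (μ := P) hsub).trans (measureReal_union_le _ _)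
  linarith

/-- Large deviations principle for the ratio `A n / D n`, where `A n` has asymptotically Gaussian
logarithmic Laplace transforms and `D n` converges to `γ > 0` superexponentially fast. -/
theorem ldp_ratio [FiniteDimensional ℝ E] [MeasurableSpace E] [BorelSpace E]
    (hνpos : ∀ n, 1 ≤ n → 0 < ν n) (hA : ∀ n, Measurable (A n))
    (hpos : ∀ u : E, u ≠ 0 → 0 < inner ℝ u (T u))
    (hT : ∀ u v : E, inner ℝ u (T v) = inner ℝ (T u) v) (hTR : ∀ w, T (R w) = w) :
    LDPWithGoodRate P Z ν (fun w => ((γ ^ 2 / 2 * inner ℝ w (R w) : ℝ) : EReal)) where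
  isSpeed := ⟨hνpos, hν⟩
  isGoodRate := by
    refine ⟨fun w => ?_, ?_, fun α => ?_⟩
    · have : 0 ≤ inner ℝ w (R w) := by
        by_cases hw : w = 0
        · simp [hw]
        · exact (inner_inverse_pos hpos hTR hw).le
      exact_mod_cast (show 0 ≤ γ ^ 2 / 2 * inner ℝ w (R w) by positivity)
    · exact (continuous_coe_real_ereal.comp
        (by fun_prop : Continuous fun w : E => γ ^ 2 / 2 * inner ℝ w (R w))).lowerSemicontinuous
    · obtain ⟨c, hc, hcoer⟩ := exists_coercive hpos hT hTR
      convert isCompact_quadratic_level hc hcoer (2 * α / γ ^ 2) using 1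
      ext w
      change ((γ ^ 2 / 2 * inner ℝ w (R w) : ℝ) : EReal) ≤ (α : EReal) ↔
        inner ℝ w (R w) ≤ 2 * α / γ ^ 2
      rw [EReal.coe_le_coe_iff, le_div_iff₀ (by positivity)]
      constructor <;> intro h <;> linarith
  lower U hU := by
    rw [EReal.neg_le]
    refine le_iInf₂ fun z hz => ?_
    rw [EReal.neg_le]
    exact le_liminf_log hν fun b hb =>
      eventually_le_ratio hν hint hΛ hγ hD hZ hA hT hTR hU hz hb
  upper V _ := by
    refine limsup_log_le hν fun b hb => ?_
    obtain ⟨b', h1, h2⟩ := EReal.lt_iff_exists_real_btwn.1 hb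
    refine eventually_ratio_le hν hint hΛ hγ hD hZ hpos hT hTR (b' := b') (by exact_mod_cast h1)
      fun w hw => ?_
    have h3 := h2.le.trans (iInf₂_le w hw)
    exact_mod_cast h3

end Ratio

/-! ### Kernel expectations -/

theorem abs_exp_sub_quadratic_le (s : ℝ) :
    |Real.exp s - 1 - s - s ^ 2 / 2| ≤ |s| ^ 3 * Real.exp |s| := by
  have h := Complex.norm_exp_sub_sum_le_norm_mul_exp (s : ℂ) 3
  rw [Complex.norm_real, Real.norm_eq_abs] at h
  convert h using 1
  rw [← Real.norm_eq_abs, ← Complex.norm_real]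
  congr 1
  push_cast
  simp [Finset.sum_range_succ]
  ring

theorem abs_cube_mul_exp_le (t : ℝ) : |t| ^ 3 * Real.exp |t| ≤ 6 * Real.exp (2 * |t|) := by
  have h := Real.pow_div_factorial_le_exp |t| (abs_nonneg t) 3
  rw [show ((3 : ℕ).factorial : ℝ) = 6 by norm_num [Nat.factorial], div_le_iff₀ (by norm_num)] at h
  rw [two_mul, Real.exp_add]
  nlinarith [Real.exp_pos |t|]

section

variable {d q : ℕ} {Ω : Type*} [MeasurableSpace Ω] {P : Measure Ω}
  {X : ℕ → Ω → EuclideanSpace ℝ (Fin d)} {Y : ℕ → Ω → EuclideanSpace ℝ (Fin q)}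
  {f : EuclideanSpace ℝ (Fin d) → EuclideanSpace ℝ (Fin q) → ℝ}

/-- `Ψ_ψ(t) = ∫ ψ(y) f(t, y) dy`. -/
def condIntegral (f : EuclideanSpace ℝ (Fin d) → EuclideanSpace ℝ (Fin q) → ℝ)
    (ψ : EuclideanSpace ℝ (Fin q) → ℝ) (t : EuclideanSpace ℝ (Fin d)) : ℝ :=
  ∫ y, ψ y * f t y

/-- `ψ` is integrable against the conditional densities, uniformly in the abscissa. -/
structure UniformlyIntegrable (f : EuclideanSpace ℝ (Fin d) → EuclideanSpace ℝ (Fin q) → ℝ)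
    (ψ : EuclideanSpace ℝ (Fin q) → ℝ) (C : ℝ) : Prop where
  measurable : Measurable ψ
  integrable : ∀ t, Integrable fun y => ψ y * f t y
  bounded : ∀ t, ∫ y, |ψ y| * f t y ≤ C

variable {ψ : EuclideanSpace ℝ (Fin q) → ℝ} {C : ℝ}

theorem UniformlyIntegrable.mono (hψ : UniformlyIntegrable f ψ C)
    (hf : ∀ t y, 0 ≤ f t y) (hfm : Measurable (Function.uncurry f))
    {ψ' : EuclideanSpace ℝ (Fin q) → ℝ} (hm : Measurable ψ') (hle : ∀ y, |ψ' y| ≤ |ψ y|) :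
    UniformlyIntegrable f ψ' C := by
  have hmt : ∀ t, Measurable (f t) := fun t => hfm.comp (measurable_const.prodMk measurable_id)
  have hi : ∀ t, Integrable fun y => ψ' y * f t y := fun t =>
    (hψ.integrable t).norm.mono' (hm.mul (hmt t)).aestronglyMeasurable (ae_of_all _ fun y => by
      rw [norm_mul, norm_mul]
      exact mul_le_mul_of_nonneg_right (hle y) (norm_nonneg _))
  have habs : ∀ (ψ : EuclideanSpace ℝ (Fin q) → ℝ) t,
      Integrable (fun y => ψ y * f t y) → Integrable fun y => |ψ y| * f t y := by
    intro ψ t h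
    refine h.abs.congr (ae_of_all _ fun y => ?_)
    simp only [abs_mul, abs_of_nonneg (hf t y)]
  refine ⟨hm, hi, fun t => le_trans ?_ (hψ.bounded t)⟩
  exact integral_mono (habs _ t (hi t)) (habs _ t (hψ.integrable t)) fun y =>
    mul_le_mul_of_nonneg_right (hle y) (hf t y)

theorem UniformlyIntegrable.abs_condIntegral_le (hψ : UniformlyIntegrable f ψ C)
    (hf : ∀ t y, 0 ≤ f t y) (t : EuclideanSpace ℝ (Fin d)) : |condIntegral f ψ t| ≤ C := by
  refine (abs_integral_le_integral_abs).trans (le_trans (le_of_eq ?_) (hψ.bounded t))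
  simp only [abs_mul, abs_of_nonneg (hf t _)]

theorem measurable_condIntegral (hfm : Measurable (Function.uncurry f)) (hψ : Measurable ψ) :
    Measurable (condIntegral f ψ) := by
  have : Measurable (Function.uncurry fun t y => ψ y * f t y) :=
    (hψ.comp measurable_snd).mul hfm
  exact (this.stronglyMeasurable.integral_prod_right).measurable

variable {κ : EuclideanSpace ℝ (Fin d) → ℝ}

theorem UniformlyIntegrable.integrable_kernel (hψ : UniformlyIntegrable f ψ C)
    (hf : ∀ t y, 0 ≤ f t y) (hfm : Measurable (Function.uncurry f)) (hκ : Integrable κ)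
    (x : EuclideanSpace ℝ (Fin d)) (h : ℝ) :
    Integrable fun z => κ z * condIntegral f ψ (x - h • z) := by
  refine (hκ.norm.mul_const C).mono' (hκ.aestronglyMeasurable.mul
    ((measurable_condIntegral hfm hψ.measurable).comp
      (by fun_prop : Measurable fun z => x - h • z)).aestronglyMeasurable)
    (ae_of_all _ fun z => ?_)
  rw [norm_mul]
  exact mul_le_mul_of_nonneg_left (hψ.abs_condIntegral_le hf _) (norm_nonneg _)

theorem UniformlyIntegrable.abs_integral_kernel_le (hψ : UniformlyIntegrable f ψ C)
    (hf : ∀ t y, 0 ≤ f t y) (hκ : Integrable κ)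
    (x : EuclideanSpace ℝ (Fin d)) (h : ℝ) :
    |∫ z, κ z * condIntegral f ψ (x - h • z)| ≤ (∫ z, |κ z|) * C := by
  rw [← integral_mul_const, ← Real.norm_eq_abs]
  refine norm_integral_le_of_norm_le (hκ.abs.mul_const C) (ae_of_all _ fun z => ?_)
  rw [norm_mul]
  exact mul_le_mul_of_nonneg_left (hψ.abs_condIntegral_le hf _) (norm_nonneg _)

theorem UniformlyIntegrable.tendsto_integral_kernel (hψ : UniformlyIntegrable f ψ C)
    (hf : ∀ t y, 0 ≤ f t y) (hfm : Measurable (Function.uncurry f)) (hκ : Integrable κ)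
    {x : EuclideanSpace ℝ (Fin d)} (hx : ContinuousAt (condIntegral f ψ) x)
    {h : ℕ → ℝ} (hh : Tendsto h atTop (𝓝 0)) :
    Tendsto (fun n => ∫ z, κ z * condIntegral f ψ (x - h n • z)) atTop
      (𝓝 ((∫ z, κ z) * condIntegral f ψ x)) := by
  rw [← integral_mul_const]
  refine tendsto_integral_of_dominated_convergence (fun z => ‖κ z‖ * C)
    (fun n => (hψ.integrable_kernel hf hfm hκ x (h n)).aestronglyMeasurable)
    (hκ.norm.mul_const C) (fun n => ae_of_all _ fun z => ?_) (ae_of_all _ fun z => ?_)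
  · rw [norm_mul]
    exact mul_le_mul_of_nonneg_left (hψ.abs_condIntegral_le hf _) (norm_nonneg _)
  · refine Tendsto.const_mul _ (hx.tendsto.comp ?_)
    simpa using tendsto_const_nhds.sub (hh.smul_const z)

/-- Change of variables for expectations of kernel-weighted functions of the sample. -/
theorem IsSample.integral_kernel (hs : IsSample P X Y f) (hψ : UniformlyIntegrable f ψ C)
    (hκm : Measurable κ) (hκ : Integrable κ) (x : EuclideanSpace ℝ (Fin d)) {h : ℝ} (hh : 0 < h)
    (i : ℕ) :
    Integrable (fun ω => κ (h⁻¹ • (x - X i ω)) * ψ (Y i ω)) P ∧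
    ∫ ω, κ (h⁻¹ • (x - X i ω)) * ψ (Y i ω) ∂P
      = h ^ d * ∫ z, κ z * condIntegral f ψ (x - h • z) := by
  have hf := hs.density_nonneg
  have hfm := hs.measurable_density
  set Φ : EuclideanSpace ℝ (Fin d) × EuclideanSpace ℝ (Fin q) → ℝ :=
    fun w => κ (h⁻¹ • (x - w.1)) * ψ w.2 with hΦ
  have hΦm : Measurable Φ :=
    (hκm.comp (by fun_prop)).mul (hψ.measurable.comp measurable_snd)
  have hXY : Measurable fun ω => (X i ω, Y i ω) := (hs.measurable_X i).prodMk (hs.measurable_Y i)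
  have hdm : Measurable fun w : EuclideanSpace ℝ (Fin d) × EuclideanSpace ℝ (Fin q) =>
      ENNReal.ofReal (f w.1 w.2) := hfm.ennreal_ofReal
  have hκh : Integrable fun t => κ (h⁻¹ • (x - t)) :=
    (hκ.comp_smul (inv_ne_zero hh.ne')).comp_sub_left x
  have hprod : Integrable
      (fun w : EuclideanSpace ℝ (Fin d) × EuclideanSpace ℝ (Fin q) => f w.1 w.2 * Φ w) := by
    have hm : Measurable fun w : EuclideanSpace ℝ (Fin d) × EuclideanSpace ℝ (Fin q) =>
        f w.1 w.2 * Φ w := hfm.mul hΦm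
    rw [Measure.volume_eq_prod, integrable_prod_iff hm.aestronglyMeasurable]
    refine ⟨ae_of_all _ fun t => ?_, ?_⟩
    · refine ((hψ.integrable t).const_mul (κ (h⁻¹ • (x - t)))).congr (ae_of_all _ fun y => ?_)
      simp only [hΦ]; ring
    · refine (hκh.norm.mul_const C).mono'
        hm.stronglyMeasurable.norm.integral_prod_right.aestronglyMeasurable
        (ae_of_all _ fun t => ?_)
      have e1 : ∀ y, ‖f t y * Φ (t, y)‖ = ‖κ (h⁻¹ • (x - t))‖ * (|ψ y| * f t y) := by
        intro y
        simp only [hΦ, norm_mul, Real.norm_of_nonneg (hf t y), Real.norm_eq_abs]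
        ring
      simp only [e1]
      rw [integral_const_mul, Real.norm_of_nonneg (mul_nonneg (norm_nonneg _)
        (integral_nonneg fun y => mul_nonneg (abs_nonneg _) (hf t y)))]
      exact mul_le_mul_of_nonneg_left (hψ.bounded t) (norm_nonneg _)
  have htoReal : ∀ w : EuclideanSpace ℝ (Fin d) × EuclideanSpace ℝ (Fin q),
      (ENNReal.ofReal (f w.1 w.2)).toReal • Φ w = f w.1 w.2 * Φ w := fun w => by
    rw [ENNReal.toReal_ofReal (hf _ _), smul_eq_mul]
  constructor
  · have h1 : Integrable Φ (P.map fun ω => (X i ω, Y i ω)) := by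
      rw [hs.law i, integrable_withDensity_iff_integrable_smul' hdm
        (ae_of_all _ fun _ => ENNReal.ofReal_lt_top)]
      simpa only [htoReal] using hprod
    exact h1.comp_measurable hXY
  · have h1 : ∫ ω, κ (h⁻¹ • (x - X i ω)) * ψ (Y i ω) ∂P
        = ∫ w, Φ w ∂(P.map fun ω => (X i ω, Y i ω)) :=
      (integral_map hXY.aemeasurable hΦm.aestronglyMeasurable).symm
    rw [h1, hs.law i, integral_withDensity_eq_integral_toReal_smul hdm
      (ae_of_all _ fun _ => ENNReal.ofReal_lt_top)]
    simp only [htoReal]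
    rw [Measure.volume_eq_prod] at hprod ⊢
    rw [integral_prod _ hprod]
    set G : EuclideanSpace ℝ (Fin d) → ℝ := fun t => κ (h⁻¹ • (x - t)) * condIntegral f ψ t with hG
    have h2 : ∀ t, ∫ y, f t y * Φ (t, y) = G t := by
      intro t
      simp only [hG, condIntegral]
      rw [← integral_const_mul]
      congr 1
      ext y
      simp only [hΦ]; ring
    simp only [h2]
    have h3 := Measure.integral_comp_smul volume (fun t => G (x - t)) h
    rw [integral_sub_left_eq_self G volume x, finrank_euclideanSpace_fin, smul_eq_mul,
      abs_of_pos (by positivity)] at h3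
    have h4 : ∀ z, G (x - h • z) = κ z * condIntegral f ψ (x - h • z) := by
      intro z
      simp only [hG, sub_sub_cancel, smul_smul, inv_mul_cancel₀ hh.ne', one_smul]
    simp only [h4] at h3
    rw [h3]
    field_simp

variable {K : EuclideanSpace ℝ (Fin d) → ℝ} {ℓ : EuclideanSpace ℝ (Fin q) → ℝ}

/-- Second-order expansion of the Laplace transform of one summand. -/
theorem IsSample.laplace_expansion [IsProbabilityMeasure P] (hs : IsSample P X Y f) (hK : A1 K) {B : ℝ} (_hB0 : 0 ≤ B)
    (hB : ∀ z, |K z| ≤ B) (hℓm : Measurable ℓ)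
    (hℓ : UniformlyIntegrable f (fun y => Real.exp (2 * |ℓ y|)) C)
    (x : EuclideanSpace ℝ (Fin d)) {h c : ℝ} (hh : 0 < h) (hc : 0 ≤ c) (hcB : c * B ≤ 1) (i : ℕ) :
    Integrable (fun ω => Real.exp (c * (K (h⁻¹ • (x - X i ω)) * ℓ (Y i ω)))) P ∧
    |∫ ω, Real.exp (c * (K (h⁻¹ • (x - X i ω)) * ℓ (Y i ω))) ∂P - 1
        - c * h ^ d * (∫ z, K z * condIntegral f ℓ (x - h • z))
        - c ^ 2 / 2 * h ^ d * (∫ z, K z ^ 2 * condIntegral f (fun y => ℓ y ^ 2) (x - h • z))|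
      ≤ c ^ 3 * h ^ d * (6 * B ^ 2 * ((∫ z, |K z|) * C)) := by
  have hf := hs.density_nonneg
  have hfm := hs.measurable_density
  have hE : ∀ t : ℝ, |t| ≤ Real.exp (2 * |t|) := fun t => by
    linarith [Real.add_one_le_exp (2 * |t|), abs_nonneg t]
  have hE2 : ∀ t : ℝ, |t ^ 2| ≤ Real.exp (2 * |t|) := fun t => by
    have := Real.pow_div_factorial_le_exp (2 * |t|) (by positivity) 2
    rw [show ((2 : ℕ).factorial : ℝ) = 2 by norm_num [Nat.factorial], mul_pow, sq_abs] at this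
    rw [abs_of_nonneg (sq_nonneg t)]
    nlinarith [sq_nonneg t]
  have hℓ1 : UniformlyIntegrable f ℓ C := hℓ.mono hf hfm hℓm fun y => by
    rw [Real.abs_exp]; exact hE _
  have hℓ2 : UniformlyIntegrable f (fun y => ℓ y ^ 2) C := hℓ.mono hf hfm (hℓm.pow_const 2)
    fun y => by rw [Real.abs_exp]; exact hE2 _
  have hK2 : Integrable fun z => K z ^ 2 := by
    refine (hK.integrable.norm.const_mul B).mono' (hK.measurable.pow_const 2).aestronglyMeasurable
      (ae_of_all _ fun z => ?_)
    rw [norm_pow, pow_two]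
    exact mul_le_mul_of_nonneg_right (hB z) (norm_nonneg _)
  obtain ⟨i1, e1⟩ := hs.integral_kernel hℓ1 hK.measurable hK.integrable x hh i
  obtain ⟨i2, e2⟩ := hs.integral_kernel hℓ2 (hK.measurable.pow_const 2) hK2 x hh i
  obtain ⟨i3, e3⟩ := hs.integral_kernel hℓ hK.measurable.abs hK.integrable.abs x hh i
  set S : Ω → ℝ := fun ω => K (h⁻¹ • (x - X i ω)) * ℓ (Y i ω) with hS
  have hSm : Measurable S := by
    have := hs.measurable_X i
    exact (hK.measurable.comp (by fun_prop)).mul (hℓm.comp (hs.measurable_Y i))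
  set ρ : Ω → ℝ := fun ω => Real.exp (c * S ω) - 1 - c * S ω - (c * S ω) ^ 2 / 2 with hρ
  have hρle : ∀ ω, ‖ρ ω‖ ≤ c ^ 3 * (6 * B ^ 2) *
      (|K (h⁻¹ • (x - X i ω))| * Real.exp (2 * |ℓ (Y i ω)|)) := by
    intro ω
    set k := K (h⁻¹ • (x - X i ω)) with hk
    set l := ℓ (Y i ω) with hl
    have hkB : |k| ≤ B := hB _
    refine (abs_exp_sub_quadratic_le (c * S ω)).trans ?_
    have h1 : |c * S ω| = c * |k| * |l| := by
      rw [abs_mul, abs_of_nonneg hc, hS, abs_mul, mul_assoc]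
    have h2 : |c * S ω| ≤ |l| := by
      rw [h1]
      refine mul_le_of_le_one_left (abs_nonneg _) (le_trans ?_ hcB)
      gcongr
    calc |c * S ω| ^ 3 * Real.exp |c * S ω|
        ≤ |c * S ω| ^ 3 * Real.exp |l| := by gcongr
      _ = c ^ 3 * (|k| ^ 2 * |k|) * (|l| ^ 3 * Real.exp |l|) := by rw [h1]; ring
      _ ≤ c ^ 3 * (B ^ 2 * |k|) * (6 * Real.exp (2 * |l|)) := by
          refine mul_le_mul ?_ (abs_cube_mul_exp_le l) (by positivity) (by positivity)
          gcongr
      _ = _ := by ring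
  have hρi : Integrable ρ P := by
    refine (i3.const_mul (c ^ 3 * (6 * B ^ 2))).mono' ?_ (ae_of_all _ hρle)
    exact (by fun_prop : Measurable ρ).aestronglyMeasurable
  have hS2 : ∀ ω, S ω ^ 2 = K (h⁻¹ • (x - X i ω)) ^ 2 * ℓ (Y i ω) ^ 2 := fun ω => mul_pow _ _ _
  have i2' : Integrable (fun ω => S ω ^ 2) P := by simpa only [hS2] using i2
  have hdec : ∀ ω, Real.exp (c * S ω) = 1 + c * S ω + c ^ 2 / 2 * S ω ^ 2 + ρ ω := by
    intro ω; simp only [hρ]; ring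
  have j1 : Integrable (fun ω => 1 + c * S ω) P := (integrable_const _).add (i1.const_mul c)
  have j2 : Integrable (fun ω => 1 + c * S ω + c ^ 2 / 2 * S ω ^ 2) P :=
    j1.add (i2'.const_mul _)
  refine ⟨(j2.add hρi).congr (ae_of_all _ fun ω => (hdec ω).symm), ?_⟩
  have hI : ∫ ω, Real.exp (c * S ω) ∂P = 1 + c * ∫ ω, S ω ∂P + c ^ 2 / 2 * ∫ ω, S ω ^ 2 ∂P
      + ∫ ω, ρ ω ∂P := by
    simp only [hdec]
    rw [integral_add j2 hρi, integral_add j1 (i2'.const_mul _),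
      integral_add (integrable_const _) (i1.const_mul c), integral_const_mul, integral_const_mul]
    simp
  have hI2 : ∫ ω, S ω ^ 2 ∂P
      = h ^ d * ∫ z, K z ^ 2 * condIntegral f (fun y => ℓ y ^ 2) (x - h • z) := by
    simp only [hS2]; exact e2
  rw [hI, hI2, e1]
  have hR : |∫ ω, ρ ω ∂P| ≤ c ^ 3 * (6 * B ^ 2) * (h ^ d * ((∫ z, |K z|) * C)) := by
    refine (norm_integral_le_of_norm_le (i3.const_mul _) (ae_of_all _ hρle)).trans ?_
    rw [integral_const_mul, e3]
    have := (le_abs_self _).trans (hℓ.abs_integral_kernel_le hf hK.integrable.abs x h)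
    simp only [abs_abs] at this
    gcongr
  calc _ = |∫ ω, ρ ω ∂P| := by congr 1; ring
    _ ≤ _ := hR
    _ = _ := by ring

theorem IsSample.laplace_sum [IsProbabilityMeasure P] (hs : IsSample P X Y f) (hK : Measurable K) (hℓ : Measurable ℓ)
    (x : EuclideanSpace ℝ (Fin d)) (h c : ℕ → ℝ) (s : Finset ℕ) :
    (∫ ω, Real.exp (∑ i ∈ s, c i * (K ((h i)⁻¹ • (x - X i ω)) * ℓ (Y i ω))) ∂P
      = ∏ i ∈ s, ∫ ω, Real.exp (c i * (K ((h i)⁻¹ • (x - X i ω)) * ℓ (Y i ω))) ∂P) ∧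
    ((∀ i ∈ s, Integrable
        (fun ω => Real.exp (c i * (K ((h i)⁻¹ • (x - X i ω)) * ℓ (Y i ω)))) P) →
      Integrable (fun ω =>
        Real.exp (∑ i ∈ s, c i * (K ((h i)⁻¹ • (x - X i ω)) * ℓ (Y i ω)))) P) := by
  let g : ℕ → EuclideanSpace ℝ (Fin d) × EuclideanSpace ℝ (Fin q) → ℝ :=
    fun i w => c i * (K ((h i)⁻¹ • (x - w.1)) * ℓ w.2)
  have hg : ∀ i, Measurable (g i) := fun i =>
    ((hK.comp (by fun_prop)).mul (hℓ.comp measurable_snd)).const_mul _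
  have hm : ∀ i, Measurable fun ω => g i (X i ω, Y i ω) := fun i =>
    (hg i).comp ((hs.measurable_X i).prodMk (hs.measurable_Y i))
  have hind : iIndepFun (fun i ω => g i (X i ω, Y i ω)) P := hs.indep.comp g hg
  have h1 := hind.mgf_sum hm s (t := 1)
  have h2 := hind.integrable_exp_mul_sum hm (s := s) (t := 1)
  simp only [mgf, one_mul, Finset.sum_apply] at h1 h2
  exact ⟨h1, h2⟩

end

/-! ### Asymptotics of the logarithmic Laplace transform -/

theorem abs_log_sub_le {w : ℝ} (hw : |w| ≤ 1 / 2) : |Real.log (1 + w) - w| ≤ 2 * w ^ 2 := by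
  obtain ⟨h1, h2⟩ := abs_le.1 hw
  have hpos : 0 < 1 + w := by linarith
  have hu := Real.log_le_sub_one_of_pos hpos
  have hl := Real.one_sub_inv_le_log_of_pos hpos
  have h3 : 1 - (1 + w)⁻¹ = w - w ^ 2 / (1 + w) := by field_simp; ring
  have h4 : w ^ 2 / (1 + w) ≤ 2 * w ^ 2 := by
    rw [div_le_iff₀ hpos]
    nlinarith [sq_nonneg w]
  rw [abs_le]
  constructor <;> nlinarith [sq_nonneg w]

theorem tendsto_sum_log {h v : ℕ → ℝ} {a : ℝ} {d : ℕ} (hd : 1 ≤ d)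
    (hreg : RegularlyVaryingSeq h (-a)) (hh : ∀ n, 1 ≤ n → 0 < h n) (ha : 0 < a) {C : ℝ}
    (hsup : ∀ n i : ℕ, 1 ≤ i → i ≤ n → h n / h i ≤ C) (hvt : Tendsto v atTop atTop)
    {b τ : ℕ → ℝ} {σ Mb Mτ C3 : ℝ} (hb : ∀ i, |b i| ≤ Mb) (hτb : ∀ i, |τ i| ≤ Mτ) (hC3 : 0 ≤ C3)
    (hbias : Tendsto (fun n : ℕ => v n * ((n : ℝ)⁻¹ * ∑ i ∈ Finset.Icc 1 n, |b i|)) atTop (𝓝 0))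
    (hτ : Tendsto τ atTop (𝓝 σ)) {e : ℕ → ℕ → ℝ}
    (he : ∀ᶠ n in atTop, ∀ i ∈ Finset.Icc 1 n,
      |e n i - 1 - (h n / h i) ^ d / v n * h i ^ d * b i
        - ((h n / h i) ^ d / v n) ^ 2 / 2 * h i ^ d * τ i|
        ≤ ((h n / h i) ^ d / v n) ^ 3 * h i ^ d * C3) :
    Tendsto (fun n : ℕ => ((n : ℝ) * h n ^ d / v n ^ 2)⁻¹ * ∑ i ∈ Finset.Icc 1 n, Real.log (e n i))
      atTop (𝓝 (σ / (1 + a * d) / 2)) := by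
  have hC : 0 ≤ C := (div_pos (hh 1 le_rfl) (hh 1 le_rfl)).le.trans (hsup 1 1 le_rfl le_rfl)
  set C' := C ^ d with hC'
  have hC'0 : 0 ≤ C' := by positivity
  have hr0 : ∀ n i, 1 ≤ i → i ≤ n → 0 ≤ (h n / h i) ^ d := fun n i h1 h2 =>
    pow_nonneg (div_pos (hh n (h1.trans h2)) (hh i h1)).le _
  have hrC : ∀ n i, 1 ≤ i → i ≤ n → (h n / h i) ^ d ≤ C' := fun n i h1 h2 =>
    pow_le_pow_left₀ (div_pos (hh n (h1.trans h2)) (hh i h1)).le (hsup n i h1 h2) _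
  have hMb : 0 ≤ Mb := (abs_nonneg _).trans (hb 0)
  have hMτ : 0 ≤ Mτ := (abs_nonneg _).trans (hτb 0)
  have hh0 : Tendsto h atTop (𝓝 0) := hreg.tendsto_zero hh ha
  have hhd : Tendsto (fun n => h n ^ d) atTop (𝓝 0) := by
    simpa [show d ≠ 0 by omega] using hh0.pow d
  have hvinv : Tendsto (fun n => (v n)⁻¹) atTop (𝓝 0) := tendsto_inv_atTop_zero.comp hvt
  set M := Mb + C' * Mτ + C' ^ 2 * C3 with hM
  have hM0 : 0 ≤ M := by positivity
  have hlin : Tendsto (fun n : ℕ => v n * ((n : ℝ)⁻¹ * ∑ i ∈ Finset.Icc 1 n, b i)) atTop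
      (𝓝 0) := by
    refine squeeze_zero_norm' ?_ hbias
    filter_upwards [hvt.eventually_ge_atTop 0] with n hn
    rw [norm_mul, norm_mul, Real.norm_of_nonneg hn, norm_inv, RCLike.norm_natCast]
    gcongr
    exact Finset.abs_sum_le_sum_abs _ _
  have hquad : Tendsto (fun n : ℕ => (n : ℝ)⁻¹ * ∑ i ∈ Finset.Icc 1 n, (h n / h i) ^ d * τ i) atTop
      (𝓝 (σ / (1 + a * d))) := by
    have h1 := (hreg.tendsto_mean_ratio_pow hh ha hsup d).const_mul σ
    have h2 : Tendsto (fun n : ℕ => (n : ℝ)⁻¹ *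
        ∑ i ∈ Finset.Icc 1 n, (h n / h i) ^ d * (τ i - σ)) atTop (𝓝 0) := by
      have h3 := (tendsto_mean_zero (τ := fun i => τ i - σ)
        (by simpa using hτ.sub_const σ)).const_mul C'
      rw [mul_zero] at h3
      refine squeeze_zero_norm (fun n => ?_) h3
      rw [norm_mul, norm_inv, RCLike.norm_natCast, mul_left_comm]
      gcongr
      rw [Finset.mul_sum]
      refine (norm_sum_le _ _).trans (Finset.sum_le_sum fun i hi => ?_)
      obtain ⟨hi1, hi2⟩ := Finset.mem_Icc.1 hi
      rw [norm_mul, Real.norm_of_nonneg (hr0 n i hi1 hi2), Real.norm_eq_abs]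
      gcongr
      exact hrC n i hi1 hi2
    have h4 := h1.add h2
    rw [add_zero, mul_one_div] at h4
    refine h4.congr fun n => ?_
    rw [mul_left_comm, ← mul_add, Finset.mul_sum, ← Finset.sum_add_distrib]
    congr 1
    exact Finset.sum_congr rfl fun i _ => by ring
  have hG := hlin.add (hquad.div_const 2)
  rw [zero_add] at hG
  have herr : Tendsto (fun n => C' ^ 2 * C3 * (v n)⁻¹ + 2 * M ^ 2 * h n ^ d) atTop (𝓝 0) := by
    simpa using (hvinv.const_mul (C' ^ 2 * C3)).add (hhd.const_mul (2 * M ^ 2))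
  have hk : Tendsto (fun n => h n ^ d * (v n)⁻¹ * M) atTop (𝓝 0) := by
    simpa using (hhd.mul hvinv).mul_const M
  refine (add_zero (σ / (1 + a * d) / 2)) ▸ (hG.add (squeeze_zero_norm' (f := fun n : ℕ =>
    ((n : ℝ) * h n ^ d / v n ^ 2)⁻¹ * ∑ i ∈ Finset.Icc 1 n, Real.log (e n i) -
    (v n * ((n : ℝ)⁻¹ * ∑ i ∈ Finset.Icc 1 n, b i) +
      ((n : ℝ)⁻¹ * ∑ i ∈ Finset.Icc 1 n, (h n / h i) ^ d * τ i) / 2)) ?_ herr)).congr fun n => by ring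
  filter_upwards [he, eventually_ge_atTop 1, hvt.eventually_ge_atTop 1,
    hk.eventually (gt_mem_nhds (show (0 : ℝ) < 1 / 2 by norm_num))] with n hen hn hvn hkn
  have hn' : (0 : ℝ) < n := by exact_mod_cast hn
  have hH := hh n hn
  have hV : 0 < v n := by linarith
  set k := h n ^ d * (v n)⁻¹ with hkdef
  have hk0 : 0 ≤ k := by positivity
  have hvle : (v n)⁻¹ ≤ 1 := inv_le_one_of_one_le₀ hvn
  have hterm : ∀ i ∈ Finset.Icc 1 n,
      |Real.log (e n i) - (k * b i + k * (v n)⁻¹ / 2 * ((h n / h i) ^ d * τ i))|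
        ≤ k * (C' * (v n)⁻¹) ^ 2 * C3 + 2 * (k * M) ^ 2 := by
    intro i hi
    obtain ⟨hi1, hi2⟩ := Finset.mem_Icc.1 hi
    have hpi := hh i hi1
    set r := (h n / h i) ^ d with hr
    have hr0' : 0 ≤ r := hr0 n i hi1 hi2
    have hrC' : r ≤ C' := hrC n i hi1 hi2
    have hrk : r / v n * h i ^ d = k := by
      rw [hr, hkdef, div_pow]; field_simp
    have h1 := hen i hi
    rw [hrk, show (r / v n) ^ 2 / 2 * h i ^ d = k * (v n)⁻¹ / 2 * r by
        rw [← hrk]; field_simp, show (r / v n) ^ 3 * h i ^ d = k * (r * (v n)⁻¹) ^ 2 by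
        rw [← hrk]; field_simp] at h1
    set w := e n i - 1 with hw
    have h2 : k * (r * (v n)⁻¹) ^ 2 * C3 ≤ k * (C' * (v n)⁻¹) ^ 2 * C3 := by gcongr
    have h3 : |w| ≤ k * M := by
      have e1 : w = (w - k * b i - k * (v n)⁻¹ / 2 * r * τ i) + k * b i
        + k * ((v n)⁻¹ / 2 * r * τ i) := by ring
      have e2 : |k * b i| ≤ k * Mb := by
        rw [abs_mul, abs_of_nonneg hk0]; gcongr; exact hb i
      have e3 : |k * ((v n)⁻¹ / 2 * r * τ i)| ≤ k * (C' * Mτ) := by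
        rw [abs_mul, abs_of_nonneg hk0, abs_mul, abs_of_nonneg (by positivity)]
        gcongr
        · calc (v n)⁻¹ / 2 * r ≤ 1 * C' := by
                gcongr
                linarith
            _ = C' := one_mul _
        · exact hτb i
      have e4 : k * (C' * (v n)⁻¹) ^ 2 * C3 ≤ k * (C' ^ 2 * C3) := by
        rw [mul_assoc]
        gcongr
        exact mul_le_of_le_one_right hC'0 hvle
      rw [e1]
      refine (abs_add_three _ _ _).trans ?_
      rw [hM]
      linarith
    have h4 := abs_log_sub_le (h3.trans hkn.le)
    rw [show 1 + w = e n i by rw [hw]; ring] at h4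
    have h5 : w ^ 2 ≤ (k * M) ^ 2 := sq_le_sq.2 (h3.trans (le_abs_self _))
    have h6 : Real.log (e n i) - (k * b i + k * (v n)⁻¹ / 2 * (r * τ i))
        = (Real.log (e n i) - w) + (w - k * b i - k * (v n)⁻¹ / 2 * r * τ i) := by ring
    rw [h6]
    refine (abs_add_le _ _).trans ?_
    linarith
  have hsum : |∑ i ∈ Finset.Icc 1 n, Real.log (e n i) - (k * ∑ i ∈ Finset.Icc 1 n, b i
      + k * (v n)⁻¹ / 2 * ∑ i ∈ Finset.Icc 1 n, (h n / h i) ^ d * τ i)|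
      ≤ n * (k * (C' * (v n)⁻¹) ^ 2 * C3 + 2 * (k * M) ^ 2) := by
    rw [Finset.mul_sum, Finset.mul_sum, ← Finset.sum_add_distrib, ← Finset.sum_sub_distrib]
    refine (Finset.abs_sum_le_sum_abs _ _).trans ((Finset.sum_le_card_nsmul _ _ _ hterm).trans ?_)
    rw [Nat.card_Icc, nsmul_eq_mul, Nat.add_sub_cancel]
  have hν0 : 0 < ((n : ℝ) * h n ^ d / v n ^ 2)⁻¹ := by positivity
  have hfin := mul_le_mul_of_nonneg_left hsum hν0.le
  rw [← abs_of_pos hν0, ← abs_mul, abs_of_pos hν0] at hfin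
  rw [Real.norm_eq_abs]
  refine le_trans (le_of_eq ?_) (hfin.trans (le_of_eq ?_))
  · congr 1
    rw [hkdef]
    field_simp
  · rw [hkdef]
    field_simp

section

variable {d q : ℕ} {Ω : Type*} [MeasurableSpace Ω] {P : Measure Ω}
  {X : ℕ → Ω → EuclideanSpace ℝ (Fin d)} {Y : ℕ → Ω → EuclideanSpace ℝ (Fin q)}
  {f : EuclideanSpace ℝ (Fin d) → EuclideanSpace ℝ (Fin q) → ℝ}
  {K : EuclideanSpace ℝ (Fin d) → ℝ} {ℓ : EuclideanSpace ℝ (Fin q) → ℝ}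
  {x : EuclideanSpace ℝ (Fin d)} {h v : ℕ → ℝ} {a C CW : ℝ}

theorem A1.integrable_sq (hK : A1 K) : Integrable fun z => K z ^ 2 := by
  obtain ⟨B, hB⟩ := hK.bounded
  refine (hK.integrable.norm.const_mul B).mono' (hK.measurable.pow_const 2).aestronglyMeasurable
    (ae_of_all _ fun z => ?_)
  rw [norm_pow, pow_two]
  exact mul_le_mul_of_nonneg_right (hB z) (norm_nonneg _)

theorem UniformlyIntegrable.of_exp (hf : ∀ t y, 0 ≤ f t y)
    (hfm : Measurable (Function.uncurry f)) (hℓm : Measurable ℓ)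
    (hℓ : UniformlyIntegrable f (fun y => Real.exp (2 * |ℓ y|)) CW) :
    UniformlyIntegrable f ℓ CW ∧ UniformlyIntegrable f (fun y => ℓ y ^ 2) CW := by
  refine ⟨hℓ.mono hf hfm hℓm fun y => ?_,
    hℓ.mono hf hfm (hℓm.pow_const 2) fun y => ?_⟩
  · rw [Real.abs_exp]
    linarith [Real.add_one_le_exp (2 * |ℓ y|), abs_nonneg (ℓ y)]
  · rw [Real.abs_exp, abs_of_nonneg (sq_nonneg _)]
    have := Real.pow_div_factorial_le_exp (2 * |ℓ y|) (by positivity) 2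
    rw [show ((2 : ℕ).factorial : ℝ) = 2 by norm_num [Nat.factorial], mul_pow, sq_abs] at this
    nlinarith [sq_nonneg (ℓ y)]

/-- Limit of the normalized logarithmic Laplace transform of the weighted kernel sums. -/
theorem IsSample.tendsto_log_laplace [IsProbabilityMeasure P] (hs : IsSample P X Y f) (hd : 1 ≤ d) (hK : A1 K)
    (hreg : RegularlyVaryingSeq h (-a)) (hh : ∀ n, 1 ≤ n → 0 < h n) (ha : 0 < a)
    (hsup : ∀ n i : ℕ, 1 ≤ i → i ≤ n → h n / h i ≤ C) (hv : ∀ n, 1 ≤ n → 0 < v n)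
    (hvt : Tendsto v atTop atTop)
    (hℓm : Measurable ℓ) (hℓ : UniformlyIntegrable f (fun y => Real.exp (2 * |ℓ y|)) CW)
    (hcont : ContinuousAt (condIntegral f fun y => ℓ y ^ 2) x)
    (hbias : Tendsto (fun n : ℕ => v n * ((n : ℝ)⁻¹ * ∑ i ∈ Finset.Icc 1 n,
      |∫ z, K z * condIntegral f ℓ (x - h i • z)|)) atTop (𝓝 0)) :
    (∀ᶠ n in atTop, Integrable (fun ω => Real.exp (∑ i ∈ Finset.Icc 1 n,
      (h n / h i) ^ d / v n * (K ((h i)⁻¹ • (x - X i ω)) * ℓ (Y i ω)))) P) ∧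
    Tendsto (fun n : ℕ => ((n : ℝ) * h n ^ d / v n ^ 2)⁻¹ * Real.log (∫ ω, Real.exp
      (∑ i ∈ Finset.Icc 1 n, (h n / h i) ^ d / v n *
        (K ((h i)⁻¹ • (x - X i ω)) * ℓ (Y i ω))) ∂P)) atTop
      (𝓝 ((∫ z, K z ^ 2) * condIntegral f (fun y => ℓ y ^ 2) x / (1 + a * d) / 2)) := by
  obtain ⟨hℓ1, hℓ2⟩ := hℓ.of_exp hs.density_nonneg hs.measurable_density hℓm
  obtain ⟨B₀, hB₀⟩ := hK.bounded
  set B := |B₀| with hBdef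
  have hB : ∀ z, |K z| ≤ B := fun z => (hB₀ z).trans (le_abs_self _)
  have hC : 0 ≤ C := (div_pos (hh 1 le_rfl) (hh 1 le_rfl)).le.trans (hsup 1 1 le_rfl le_rfl)
  have hf := hs.density_nonneg
  have hfm := hs.measurable_density
  have hCW : 0 ≤ CW := (abs_nonneg _).trans (hℓ1.abs_condIntegral_le hf x)
  have hexp : ∀ᶠ n in atTop, ∀ i ∈ Finset.Icc 1 n,
      Integrable (fun ω => Real.exp ((h n / h i) ^ d / v n *
        (K ((h i)⁻¹ • (x - X i ω)) * ℓ (Y i ω)))) P ∧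
      |∫ ω, Real.exp ((h n / h i) ^ d / v n * (K ((h i)⁻¹ • (x - X i ω)) * ℓ (Y i ω))) ∂P - 1
        - (h n / h i) ^ d / v n * h i ^ d * (∫ z, K z * condIntegral f ℓ (x - h i • z))
        - ((h n / h i) ^ d / v n) ^ 2 / 2 * h i ^ d *
          (∫ z, K z ^ 2 * condIntegral f (fun y => ℓ y ^ 2) (x - h i • z))|
      ≤ ((h n / h i) ^ d / v n) ^ 3 * h i ^ d * (6 * B ^ 2 * ((∫ z, |K z|) * CW)) := by
    filter_upwards [eventually_ge_atTop 1, hvt.eventually_ge_atTop (C ^ d * B)] with n hn hvn i hi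
    obtain ⟨hi1, hi2⟩ := Finset.mem_Icc.1 hi
    have hr0 : 0 ≤ h n / h i := (div_pos (hh n hn) (hh i hi1)).le
    have hV := hv n hn
    refine hs.laplace_expansion hK (abs_nonneg _) hB hℓm hℓ x (hh i hi1)
      (div_nonneg (pow_nonneg hr0 _) hV.le) ?_ i
    rw [div_mul_eq_mul_div, div_le_one hV]
    refine le_trans ?_ hvn
    gcongr
    exact hsup n i hi1 hi2
  refine ⟨?_, ?_⟩
  · filter_upwards [hexp] with n hn
    exact (hs.laplace_sum hK.measurable hℓm x h _ _).2 fun i hi => (hn i hi).1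
  · have h1 := tendsto_sum_log hd hreg hh ha hsup hvt
      (b := fun i => ∫ z, K z * condIntegral f ℓ (x - h i • z))
      (τ := fun i => ∫ z, K z ^ 2 * condIntegral f (fun y => ℓ y ^ 2) (x - h i • z))
      (e := fun n i => ∫ ω, Real.exp ((h n / h i) ^ d / v n *
        (K ((h i)⁻¹ • (x - X i ω)) * ℓ (Y i ω))) ∂P)
      (C3 := 6 * B ^ 2 * ((∫ z, |K z|) * CW))
      (fun i => hℓ1.abs_integral_kernel_le hf hK.integrable x (h i))
      (fun i => hℓ2.abs_integral_kernel_le hf hK.integrable_sq x (h i))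
      (by have : 0 ≤ ∫ z, |K z| := integral_nonneg fun z => abs_nonneg _
          positivity) hbias
      (hℓ2.tendsto_integral_kernel hf hfm hK.integrable_sq hcont (hreg.tendsto_zero hh ha))
      (hexp.mono fun n hn i hi => (hn i hi).2)
    refine h1.congr' ?_
    filter_upwards [hexp] with n hn
    rw [(hs.laplace_sum hK.measurable hℓm x h _ _).1, Real.log_prod]
    exact fun i hi => (integral_exp_pos (hn i hi).1).ne'

set_option maxHeartbeats 1000000 in
/-- One-sided superexponential concentration of `g̃_n(x)`. -/
theorem IsSample.eventually_gTilde_le [IsProbabilityMeasure P] (hs : IsSample P X Y f) (hK : A1 K)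
    (hreg : RegularlyVaryingSeq h (-a)) (hh : ∀ n, 1 ≤ n → 0 < h n) (ha : 0 < a)
    (hsup : ∀ n i : ℕ, 1 ≤ i → i ≤ n → h n / h i ≤ C) (hv : ∀ n, 1 ≤ n → 0 < v n)
    (hvt : Tendsto v atTop atTop)
    (hν : Tendsto (fun n : ℕ => (n : ℝ) * h n ^ d / v n ^ 2) atTop atTop)
    (s : ℝ) (hs1 : UniformlyIntegrable f (fun _ => Real.exp (2 * |s|)) CW)
    (hcont : ContinuousAt (condIntegral f fun _ => s) x) {δ : ℝ} (hδ : 0 < δ) (L : ℝ) :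
    ∀ᶠ n : ℕ in atTop, P.real {ω | condIntegral f (fun _ => s) x + δ ≤ s * gTilde K h X x n ω}
      ≤ Real.exp (-((n : ℝ) * h n ^ d / v n ^ 2 * L)) := by
  have hℓm : Measurable fun _ : EuclideanSpace ℝ (Fin q) => s := measurable_const
  obtain ⟨hℓ1, hℓ2⟩ := UniformlyIntegrable.of_exp hs.density_nonneg hs.measurable_density hℓm hs1
  obtain ⟨B₀, hB₀⟩ := hK.bounded
  set B := |B₀| with hBdef
  have hB0 : 0 ≤ B := abs_nonneg _
  have hB : ∀ z, |K z| ≤ B := fun z => (hB₀ z).trans (le_abs_self _)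
  have hC : 0 ≤ C := (div_pos (hh 1 le_rfl) (hh 1 le_rfl)).le.trans (hsup 1 1 le_rfl le_rfl)
  have hf := hs.density_nonneg
  have hfm := hs.measurable_density
  have hCW : 0 ≤ CW := (abs_nonneg _).trans (hℓ1.abs_condIntegral_le hf x)
  set G := condIntegral f (fun _ => s) x with hG
  set C' := C ^ d with hC'
  set Mτ := (∫ z, |K z ^ 2|) * CW with hMτ
  set C3 := 6 * B ^ 2 * ((∫ z, |K z|) * CW) with hC3
  have hC30 : 0 ≤ C3 := by
    have : 0 ≤ ∫ z, |K z| := integral_nonneg fun z => abs_nonneg _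
    positivity
  have hMτ0 : 0 ≤ Mτ := by
    have : 0 ≤ ∫ z, |K z ^ 2| := integral_nonneg fun z => abs_nonneg _
    positivity
  set M := C' * Mτ + C' ^ 2 * C3 with hM
  have hM0 : 0 ≤ M := by positivity
  obtain ⟨θ, hθ0, hθ1, hθB, hθM⟩ : ∃ θ > 0, θ ≤ 1 ∧ θ * (C' * B) ≤ 1 ∧ θ * M ≤ δ / 4 := by
    refine ⟨min 1 (min (1 / (C' * B + 1)) (δ / 4 / (M + 1))), by positivity, min_le_left _ _, ?_, ?_⟩
    · have h1 : min 1 (min (1 / (C' * B + 1)) (δ / 4 / (M + 1))) ≤ 1 / (C' * B + 1) :=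
        (min_le_right _ _).trans (min_le_left _ _)
      refine (mul_le_mul_of_nonneg_right h1 (by positivity)).trans ?_
      rw [one_div, inv_mul_le_iff₀ (by positivity)]
      linarith
    · have h1 : min 1 (min (1 / (C' * B + 1)) (δ / 4 / (M + 1))) ≤ δ / 4 / (M + 1) :=
        (min_le_right _ _).trans (min_le_right _ _)
      refine (mul_le_mul_of_nonneg_right h1 hM0).trans ?_
      rw [div_mul_eq_mul_div, div_le_iff₀ (by positivity)]
      nlinarith
  set b : ℕ → ℝ := fun i => ∫ z, K z * condIntegral f (fun _ => s) (x - h i • z) with hb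
  have hblim : Tendsto b atTop (𝓝 G) := by
    have := hℓ1.tendsto_integral_kernel hf hfm hK.integrable hcont (hreg.tendsto_zero hh ha)
    rwa [hK.integral_eq_one, one_mul] at this
  have hmean := tendsto_mean_zero (τ := fun i => b i - G) (by simpa using hblim.sub_const G)
  filter_upwards [eventually_ge_atTop 1, hmean.eventually (gt_mem_nhds (show 0 < δ / 4 by positivity)),
    hvt.eventually_ge_atTop 1, hvt.eventually_ge_atTop (2 * L / (θ * δ)),
    hν.eventually_gt_atTop 0] with n hn hmn hv1 hvL hνn
  have hn' : (0 : ℝ) < n := by exact_mod_cast hn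
  have hH := hh n hn
  set k := θ * h n ^ d with hk
  have hk0 : 0 < k := by positivity
  have hexp : ∀ i ∈ Finset.Icc 1 n,
      Integrable (fun ω => Real.exp (θ * (h n / h i) ^ d *
        (K ((h i)⁻¹ • (x - X i ω)) * s))) P ∧
      ∫ ω, Real.exp (θ * (h n / h i) ^ d * (K ((h i)⁻¹ • (x - X i ω)) * s)) ∂P
        ≤ Real.exp (k * (b i + δ / 4)) := by
    intro i hi
    obtain ⟨hi1, hi2⟩ := Finset.mem_Icc.1 hi
    have hpi := hh i hi1
    have hr0 : 0 ≤ h n / h i := (div_pos hH hpi).le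
    set r := (h n / h i) ^ d with hr
    have hr0' : 0 ≤ r := by positivity
    have hrC : r ≤ C' := pow_le_pow_left₀ hr0 (hsup n i hi1 hi2) _
    have hrk : θ * r * h i ^ d = k := by rw [hr, hk, div_pow]; field_simp
    obtain ⟨h1, h2⟩ := hs.laplace_expansion hK hB0 hB hℓm hs1 x hpi
      (c := θ * r) (by positivity) (by
        refine le_trans ?_ hθB
        rw [mul_assoc]
        gcongr) i
    refine ⟨h1, ?_⟩
    have h3 := (abs_le.1 h2).2
    set τ := ∫ z, K z ^ 2 * condIntegral f (fun _ => s ^ 2) (x - h i • z) with hτ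
    have hτM : τ ≤ Mτ := (le_abs_self _).trans
      (hℓ2.abs_integral_kernel_le hf hK.integrable_sq x (h i))
    change _ - 1 - θ * r * h i ^ d * b i - (θ * r) ^ 2 / 2 * h i ^ d * τ ≤
      (θ * r) ^ 3 * h i ^ d * C3 at h3
    rw [show (θ * r) ^ 2 / 2 * h i ^ d = k * (θ * (r / 2)) by rw [← hrk]; ring,
      show (θ * r) ^ 3 * h i ^ d = k * (θ * (θ * r ^ 2)) by rw [← hrk]; ring, hrk] at h3
    have h4 : k * (θ * (r / 2)) * τ ≤ k * (θ * (C' * Mτ)) := by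
      have e1 : r / 2 * τ ≤ C' * Mτ :=
        (mul_le_mul_of_nonneg_left hτM (by positivity)).trans
          (mul_le_mul_of_nonneg_right (by linarith) hMτ0)
      have e2 := mul_le_mul_of_nonneg_left e1 (mul_pos hk0 hθ0).le
      linarith
    have h5 : k * (θ * (θ * r ^ 2)) * C3 ≤ k * (θ * (C' ^ 2 * C3)) := by
      have e1 : θ * r ^ 2 * C3 ≤ 1 * C' ^ 2 * C3 := by gcongr
      have e2 := mul_le_mul_of_nonneg_left e1 (mul_pos hk0 hθ0).le
      linarith
    have h6 : k * (θ * M) ≤ k * (δ / 4) := by gcongr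
    refine le_trans ?_ (Real.add_one_le_exp _)
    rw [hM] at h6
    linarith
  obtain ⟨hprod, hintg⟩ := hs.laplace_sum hK.measurable hℓm x h
    (fun i => θ * (h n / h i) ^ d) (Finset.Icc 1 n)
  have hsumeq : ∀ ω, (n : ℝ) * k * (s * gTilde K h X x n ω) = ∑ i ∈ Finset.Icc 1 n,
      θ * (h n / h i) ^ d * (K ((h i)⁻¹ • (x - X i ω)) * s) := by
    intro ω
    rw [gTilde, show (n : ℝ) * k * (s * ((n : ℝ)⁻¹ * ∑ i ∈ Finset.Icc 1 n,
      K ((h i)⁻¹ • (x - X i ω)) / h i ^ d)) = (k * s) * ∑ i ∈ Finset.Icc 1 n,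
      K ((h i)⁻¹ • (x - X i ω)) / h i ^ d by field_simp, Finset.mul_sum]
    refine Finset.sum_congr rfl fun i hi => ?_
    have hpi := hh i (Finset.mem_Icc.1 hi).1
    rw [hk, div_pow]
    field_simp
  have hint : Integrable (fun ω => Real.exp ((n : ℝ) * k * (s * gTilde K h X x n ω))) P := by
    simp only [hsumeq]
    exact hintg fun i hi => (hexp i hi).1
  have hmgf : mgf (fun ω => s * gTilde K h X x n ω) P (n * k) ≤
      Real.exp (n * k * (G + δ / 2)) := by
    rw [mgf]
    simp only [hsumeq]
    rw [hprod]
    refine (Finset.prod_le_prod (fun i hi => (integral_exp_pos (hexp i hi).1).le)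
      fun i hi => (hexp i hi).2).trans ?_
    rw [← Real.exp_sum, ← Finset.mul_sum, Real.exp_le_exp]
    have h1 : ∑ i ∈ Finset.Icc 1 n, (b i + δ / 4) ≤ n * (G + δ / 2) := by
      have h2 : ∑ i ∈ Finset.Icc 1 n, (b i + δ / 4) ≤
          ∑ i ∈ Finset.Icc 1 n, |b i - G| + n * (G + δ / 4) := by
        have h3 : (n : ℝ) * (G + δ / 4) = ∑ i ∈ Finset.Icc 1 n, (G + δ / 4) := by
          rw [Finset.sum_const, Nat.card_Icc, nsmul_eq_mul, Nat.add_sub_cancel]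
        rw [h3, ← Finset.sum_add_distrib]
        exact Finset.sum_le_sum fun i _ => by linarith [le_abs_self (b i - G)]
      rw [inv_mul_lt_iff₀ hn'] at hmn
      linarith
    calc k * ∑ i ∈ Finset.Icc 1 n, (b i + δ / 4) ≤ k * (n * (G + δ / 2)) := by gcongr
      _ = _ := by ring
  refine (measure_ge_le_exp_mul_mgf (X := fun ω => s * gTilde K h X x n ω) (G + δ)
    (by positivity : (0 : ℝ) ≤ n * k) hint).trans ?_
  refine (mul_le_mul_of_nonneg_left hmgf (Real.exp_pos _).le).trans ?_
  rw [← Real.exp_add, Real.exp_le_exp]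
  have hV : 0 < v n := hv n hn
  have h1 : (n : ℝ) * k = (n : ℝ) * h n ^ d / v n ^ 2 * (θ * v n ^ 2) := by
    rw [hk]; field_simp
  have h2 : 2 * L ≤ θ * v n ^ 2 * δ := by
    rw [div_le_iff₀ (by positivity)] at hvL
    have : v n ≤ v n ^ 2 := by nlinarith
    have h3 : v n * (θ * δ) ≤ v n ^ 2 * (θ * δ) := by gcongr
    linarith
  rw [h1]
  nlinarith

end

/-! ### The regression model -/

section

variable {d q : ℕ} {f : EuclideanSpace ℝ (Fin d) → EuclideanSpace ℝ (Fin q) → ℝ}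
  {x : EuclideanSpace ℝ (Fin d)}

theorem A2.uniformlyIntegrable_exp (hA2 : A2 f x) (u : EuclideanSpace ℝ (Fin q)) :
    ∃ C, UniformlyIntegrable f (fun y => Real.exp (inner ℝ u y)) C := by
  obtain ⟨C, hC⟩ := hA2.bounded u
  exact ⟨C, by fun_prop, hA2.integrable u, by simpa only [Real.abs_exp] using hC⟩

theorem A2.integrable_density (hA2 : A2 f x) (t : EuclideanSpace ℝ (Fin d)) :
    Integrable (f t) := by
  simpa using hA2.integrable 0 t

theorem A2.uniformlyIntegrable_exp_abs (hA2 : A2 f x) (hf : ∀ t y, 0 ≤ f t y)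
    (hfm : Measurable (Function.uncurry f)) (u r : EuclideanSpace ℝ (Fin q)) :
    ∃ C, UniformlyIntegrable f (fun y => Real.exp (2 * |inner ℝ u (y - r)|)) C := by
  obtain ⟨C₁, h₁⟩ := hA2.uniformlyIntegrable_exp ((2 : ℝ) • u)
  obtain ⟨C₂, h₂⟩ := hA2.uniformlyIntegrable_exp ((-2 : ℝ) • u)
  set c₁ := Real.exp (-(2 * inner ℝ u r))
  set c₂ := Real.exp (2 * inner ℝ u r)
  set W : EuclideanSpace ℝ (Fin q) → ℝ := fun y =>
    c₁ * Real.exp (inner ℝ ((2 : ℝ) • u) y) + c₂ * Real.exp (inner ℝ ((-2 : ℝ) • u) y) with hW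
  have hWpos : ∀ y, 0 ≤ W y := fun y => by positivity
  have hsplit : ∀ t y, W y * f t y = c₁ * (Real.exp (inner ℝ ((2 : ℝ) • u) y) * f t y)
      + c₂ * (Real.exp (inner ℝ ((-2 : ℝ) • u) y) * f t y) := fun t y => by
    simp only [hW]; ring
  have hWu : UniformlyIntegrable f W (c₁ * C₁ + c₂ * C₂) := by
    refine ⟨by fun_prop, fun t => ?_, fun t => ?_⟩
    · simp only [hsplit]
      exact ((h₁.integrable t).const_mul _).add ((h₂.integrable t).const_mul _)
    · simp only [abs_of_nonneg (hWpos _), hsplit]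
      rw [integral_add ((h₁.integrable t).const_mul _) ((h₂.integrable t).const_mul _),
        integral_const_mul, integral_const_mul]
      have e₁ := h₁.bounded t
      have e₂ := h₂.bounded t
      simp only [Real.abs_exp] at e₁ e₂
      gcongr
  refine ⟨_, hWu.mono hf hfm (by fun_prop) fun y => ?_⟩
  rw [Real.abs_exp, abs_of_nonneg (hWpos y)]
  have e₁ : c₁ * Real.exp (inner ℝ ((2 : ℝ) • u) y) = Real.exp (2 * inner ℝ u (y - r)) := by
    rw [← Real.exp_add, real_inner_smul_left, inner_sub_right]; ring_nf
  have e₂ : c₂ * Real.exp (inner ℝ ((-2 : ℝ) • u) y) = Real.exp (-(2 * inner ℝ u (y - r))) := by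
    rw [← Real.exp_add, real_inner_smul_left, inner_sub_right]; ring_nf
  simp only [hW]
  rw [e₁, e₂]
  rcases abs_cases (inner ℝ u (y - r)) with ⟨h, _⟩ | ⟨h, _⟩ <;> rw [h]
  · linarith [Real.exp_pos (-(2 * inner ℝ u (y - r)))]
  · rw [mul_neg]
    linarith [Real.exp_pos (2 * inner ℝ u (y - r))]

theorem A2.continuousAt_marginal (hA2 : A2 f x) : ContinuousAt (marginal f) x := by
  have h := hA2.continuousAt 0
  simp only [inner_zero_left, Real.exp_zero, one_mul] at h
  exact h

section Moments

variable (hA2 : A2 f x) (hf : ∀ t y, 0 ≤ f t y) (hfm : Measurable (Function.uncurry f))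

include hA2 hf hfm

theorem A2.integrable_inner (u : EuclideanSpace ℝ (Fin q)) (t : EuclideanSpace ℝ (Fin d)) :
    Integrable fun y => inner ℝ u y * f t y := by
  obtain ⟨C, hC⟩ := hA2.uniformlyIntegrable_exp_abs hf hfm u 0
  simp only [sub_zero] at hC
  exact (hC.of_exp hf hfm (ℓ := fun y => inner ℝ u y) (by fun_prop)).1.integrable t

theorem A2.integrable_inner_sq (u : EuclideanSpace ℝ (Fin q)) (t : EuclideanSpace ℝ (Fin d)) :
    Integrable fun y => inner ℝ u y ^ 2 * f t y := by
  obtain ⟨C, hC⟩ := hA2.uniformlyIntegrable_exp_abs hf hfm u 0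
  simp only [sub_zero] at hC
  exact (hC.of_exp hf hfm (ℓ := fun y => inner ℝ u y) (by fun_prop)).2.integrable t

theorem A2.integrable_smul (t : EuclideanSpace ℝ (Fin d)) :
    Integrable fun y : EuclideanSpace ℝ (Fin q) => f t y • y := by
  have hmt : Measurable (f t) := hfm.comp (measurable_const.prodMk measurable_id)
  have hS : Integrable fun y : EuclideanSpace ℝ (Fin q) =>
      ∑ k, |inner ℝ (EuclideanSpace.single k (1 : ℝ)) y * f t y| :=
    integrable_finsetSum _ fun k _ => (hA2.integrable_inner hf hfm _ t).abs
  refine hS.mono' (by fun_prop) (ae_of_all _ fun y => ?_)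
  rw [norm_smul, Real.norm_of_nonneg (hf t y)]
  simp only [abs_mul, abs_of_nonneg (hf t y)]
  rw [← Finset.sum_mul, mul_comm]
  refine mul_le_mul_of_nonneg_right ((norm_le_sum_abs y).trans (le_of_eq ?_)) (hf t y)
  simp [EuclideanSpace.inner_single_left]

theorem A2.condIntegral_inner (u r : EuclideanSpace ℝ (Fin q)) (t : EuclideanSpace ℝ (Fin d)) :
    condIntegral f (fun y => inner ℝ u (y - r)) t
      = inner ℝ u (firstMoment f t) - inner ℝ u r * marginal f t := by
  rw [condIntegral, firstMoment, marginal, ← integral_inner (hA2.integrable_smul hf hfm t) u,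
    ← integral_const_mul, ← integral_sub]
  · congr 1
    ext y
    rw [inner_sub_right, real_inner_smul_right]; ring
  · exact (hA2.integrable_smul hf hfm t).const_inner u
  · exact (hA2.integrable_density t).const_mul _

theorem A2.condIntegral_inner_sq (u r : EuclideanSpace ℝ (Fin q)) (t : EuclideanSpace ℝ (Fin d)) :
    condIntegral f (fun y => inner ℝ u (y - r) ^ 2) t
      = (∫ y, inner ℝ u y ^ 2 * f t y) - 2 * inner ℝ u r * (∫ y, inner ℝ u y * f t y)
        + inner ℝ u r ^ 2 * marginal f t := by
  have i1 := hA2.integrable_inner_sq hf hfm u t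
  have i2 := (hA2.integrable_inner hf hfm u t).const_mul (2 * inner ℝ u r)
  have i3 := (hA2.integrable_density t).const_mul (inner ℝ u r ^ 2)
  have i12 : Integrable fun y => inner ℝ u y ^ 2 * f t y
      - 2 * inner ℝ u r * (inner ℝ u y * f t y) := i1.sub i2
  rw [condIntegral, marginal, ← integral_const_mul, ← integral_const_mul, ← integral_sub i1 i2,
    ← integral_add i12 i3]
  congr 1
  ext y
  rw [inner_sub_right]
  ring

theorem A2.continuousAt_condIntegral_inner_sq (hA3 : A3 f x) (u r : EuclideanSpace ℝ (Fin q)) :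
    ContinuousAt (condIntegral f fun y => inner ℝ u (y - r) ^ 2) x := by
  have h1 : (condIntegral f fun y => inner ℝ u (y - r) ^ 2) = fun t =>
      (∫ y, inner ℝ u y ^ 2 * f t y) - 2 * inner ℝ u r * (∫ y, inner ℝ u y * f t y)
        + inner ℝ u r ^ 2 * marginal f t := by
    ext t; exact hA2.condIntegral_inner_sq hf hfm u r t
  rw [h1]
  exact ((hA3.continuousAt_sq u).sub ((hA3.continuousAt_one u).const_mul _)).add
    (hA2.continuousAt_marginal.const_mul _)

theorem A2.dotProduct_condCov (hg : marginal f x ≠ 0) (u : EuclideanSpace ℝ (Fin q)) :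
    marginal f x * (u.ofLp ⬝ᵥ (condCov f x).mulVec u.ofLp)
      = condIntegral f (fun y => inner ℝ u (y - regression f x) ^ 2) x := by
  set r := regression f x with hr
  have hprod : ∀ k l : Fin q, Integrable fun y : EuclideanSpace ℝ (Fin q) =>
      (y k - r k) * (y l - r l) * f x y := by
    intro k l
    have hsq : ∀ k : Fin q, Integrable fun y : EuclideanSpace ℝ (Fin q) =>
        (y k - r k) ^ 2 * f x y := by
      intro k
      obtain ⟨C, hC⟩ := hA2.uniformlyIntegrable_exp_abs hf hfm (EuclideanSpace.single k 1) r
      have := (hC.of_exp hf hfm (ℓ := fun y => inner ℝ (EuclideanSpace.single k (1 : ℝ)) (y - r))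
        (by fun_prop)).2.integrable x
      simpa [EuclideanSpace.inner_single_left] using this
    have hmt : Measurable (f x) := hfm.comp (measurable_const.prodMk measurable_id)
    refine ((hsq k).add (hsq l)).mono' (by fun_prop) (ae_of_all _ fun y => ?_)
    rw [norm_mul, Real.norm_of_nonneg (hf x y), Pi.add_apply, ← add_mul]
    refine mul_le_mul_of_nonneg_right ?_ (hf x y)
    rw [Real.norm_eq_abs, abs_le]
    constructor <;>
    nlinarith [sq_nonneg (y k - r k + (y l - r l)), sq_nonneg (y k - r k - (y l - r l)),
      sq_nonneg (y k - r k), sq_nonneg (y l - r l)]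
  have hexp : ∀ y : EuclideanSpace ℝ (Fin q), inner ℝ u (y - r) ^ 2 * f x y =
      ∑ k, ∑ l, u k * u l * ((y k - r k) * (y l - r l) * f x y) := by
    intro y
    have h1 : inner ℝ u (y - r) = ∑ k, u k * (y k - r k) := by
      simp [PiLp.inner_apply, mul_comm]
    rw [h1, pow_two, Finset.sum_mul_sum, Finset.sum_mul]
    refine Finset.sum_congr rfl fun k _ => ?_
    rw [Finset.sum_mul]
    exact Finset.sum_congr rfl fun l _ => by ring
  rw [condIntegral]
  simp only [hexp]
  rw [integral_finsetSum _ fun k _ => integrable_finsetSum _ fun l _ => (hprod k l).const_mul _]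
  rw [dotProduct, Finset.mul_sum]
  refine Finset.sum_congr rfl fun k _ => ?_
  rw [integral_finsetSum _ fun l _ => (hprod k l).const_mul _, Matrix.mulVec, dotProduct,
    Finset.mul_sum, Finset.mul_sum]
  refine Finset.sum_congr rfl fun l _ => ?_
  rw [integral_const_mul, condCov, Matrix.of_apply, ← hr]
  field_simp

theorem A2.condIntegral_inner_sq_pos (hg : marginal f x ≠ 0) {u : EuclideanSpace ℝ (Fin q)}
    (hu : u ≠ 0) (r : EuclideanSpace ℝ (Fin q)) :
    0 < condIntegral f (fun y => inner ℝ u (y - r) ^ 2) x := by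
  obtain ⟨C, hC⟩ := hA2.uniformlyIntegrable_exp_abs hf hfm u r
  have hi := (hC.of_exp hf hfm (ℓ := fun y => inner ℝ u (y - r)) (by fun_prop)).2.integrable x
  have hnn : ∀ y, 0 ≤ inner ℝ u (y - r) ^ 2 * f x y := fun y =>
    mul_nonneg (sq_nonneg _) (hf x y)
  refine lt_of_le_of_ne (integral_nonneg hnn) fun h0 => hg ?_
  have h1 := (integral_eq_zero_iff_of_nonneg hnn hi).1 h0.symm
  have hnull : ∀ᵐ y : EuclideanSpace ℝ (Fin q), inner ℝ u (y - r) ≠ 0 := by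
    set S := LinearMap.ker (innerSL ℝ u).toLinearMap with hS
    have hSne : S ≠ ⊤ := by
      intro h
      have h2 : u ∈ S := h ▸ Submodule.mem_top
      have h3 : inner ℝ u u = 0 := h2
      exact hu (inner_self_eq_zero.1 h3)
    have h2 := Measure.addHaar_submodule volume S hSne
    have h3 := measure_preimage_add_right volume (-r) (S : Set (EuclideanSpace ℝ (Fin q)))
    rw [h2] at h3
    rw [ae_iff]
    convert h3 using 2
    ext y
    simp [hS, sub_eq_add_neg]
  refine integral_eq_zero_of_ae ?_
  filter_upwards [h1, hnull] with y hy1 hy2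
  have : inner ℝ u (y - r) ^ 2 * f x y = 0 := hy1
  rcases mul_eq_zero.1 this with h | h
  · exact absurd h (pow_ne_zero 2 hy2)
  · exact h

theorem A2.posDef_condCov (hA3 : A3 f x) : (condCov f x).PosDef := by
  have hg : 0 < marginal f x :=
    lt_of_le_of_ne (integral_nonneg (hf x)) (Ne.symm hA3.marginal_ne_zero)
  refine Matrix.PosDef.of_dotProduct_mulVec_pos ?_ fun u hu => ?_
  · ext k l
    simp only [condCov, Matrix.conjTranspose_apply, Matrix.of_apply, star_trivial]
    congr 2
    ext y
    ring
  · have h1 := hA2.dotProduct_condCov hf hfm hg.ne' (WithLp.toLp 2 u)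
    have h2 := hA2.condIntegral_inner_sq_pos hf hfm hg.ne'
      (u := WithLp.toLp 2 u) (by simpa using hu) (regression f x)
    rw [← h1] at h2
    simpa using pos_of_mul_pos_right h2 hg.le

end Moments

theorem inner_toEuclideanCLM (M : Matrix (Fin q) (Fin q) ℝ) (u w : EuclideanSpace ℝ (Fin q)) :
    inner ℝ u (Matrix.toEuclideanCLM (𝕜 := ℝ) M w) = u.ofLp ⬝ᵥ M.mulVec w.ofLp := by
  rw [EuclideanSpace.inner_eq_star_dotProduct, Matrix.ofLp_toEuclideanCLM, star_trivial,
    dotProduct_comm]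

theorem A1.integral_sq_pos {K : EuclideanSpace ℝ (Fin d) → ℝ} (hK : A1 K) :
    0 < ∫ z, K z ^ 2 := by
  refine lt_of_le_of_ne (integral_nonneg fun z => sq_nonneg _) fun h0 => ?_
  have h1 := (integral_eq_zero_iff_of_nonneg (fun z => sq_nonneg (K z)) hK.integrable_sq).1 h0.symm
  have h2 : ∫ z, K z = 0 := integral_eq_zero_of_ae (h1.mono fun z hz => by
    simpa using hz)
  rw [hK.integral_eq_one] at h2
  exact one_ne_zero h2

end

section

variable {d q : ℕ} {Ω : Type*} {X : ℕ → Ω → EuclideanSpace ℝ (Fin d)}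
  {Y : ℕ → Ω → EuclideanSpace ℝ (Fin q)} {K : EuclideanSpace ℝ (Fin d) → ℝ}
  {x : EuclideanSpace ℝ (Fin d)} {h v : ℕ → ℝ}

/-- The centered and rescaled numerator `v_n (m̃_n(x) - g̃_n(x) r)`. -/
def centeredNumerator (K : EuclideanSpace ℝ (Fin d) → ℝ) (h v : ℕ → ℝ)
    (X : ℕ → Ω → EuclideanSpace ℝ (Fin d)) (Y : ℕ → Ω → EuclideanSpace ℝ (Fin q))
    (x : EuclideanSpace ℝ (Fin d)) (r : EuclideanSpace ℝ (Fin q)) (n : ℕ) (ω : Ω) :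
    EuclideanSpace ℝ (Fin q) :=
  v n • (mTilde K h X Y x n ω - gTilde K h X x n ω • r)

theorem speed_mul_inner_centeredNumerator (hh : ∀ n, 1 ≤ n → 0 < h n) (hv : ∀ n, 1 ≤ n → 0 < v n)
    (u r : EuclideanSpace ℝ (Fin q)) {n : ℕ} (hn : 1 ≤ n) (ω : Ω) :
    (n : ℝ) * h n ^ d / v n ^ 2 * inner ℝ u (centeredNumerator K h v X Y x r n ω)
      = ∑ i ∈ Finset.Icc 1 n, (h n / h i) ^ d / v n *
        (K ((h i)⁻¹ • (x - X i ω)) * inner ℝ u (Y i ω - r)) := by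
  have hn' : (0 : ℝ) < n := by exact_mod_cast hn
  have hV := hv n hn
  have h1 : inner ℝ u (centeredNumerator K h v X Y x r n ω) = v n * (n : ℝ)⁻¹ *
      ∑ i ∈ Finset.Icc 1 n, K ((h i)⁻¹ • (x - X i ω)) / h i ^ d * inner ℝ u (Y i ω - r) := by
    rw [centeredNumerator, mTilde, gTilde, real_inner_smul_right, inner_sub_right,
      real_inner_smul_right, real_inner_smul_right, inner_sum, mul_assoc (n : ℝ)⁻¹, ← mul_sub,
      Finset.sum_mul, ← Finset.sum_sub_distrib, mul_assoc]
    congr 2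
    refine Finset.sum_congr rfl fun i _ => ?_
    rw [real_inner_smul_right, inner_sub_right]
    ring
  rw [h1, ← mul_assoc, Finset.mul_sum]
  refine Finset.sum_congr rfl fun i hi => ?_
  have hpi := hh i (Finset.mem_Icc.1 hi).1
  rw [div_pow]
  field_simp

end

section

variable {d q : ℕ} {Ω : Type*} [MeasurableSpace Ω] {P : Measure Ω}
  {X : ℕ → Ω → EuclideanSpace ℝ (Fin d)} {Y : ℕ → Ω → EuclideanSpace ℝ (Fin q)}
  {f : EuclideanSpace ℝ (Fin d) → EuclideanSpace ℝ (Fin q) → ℝ}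
  {K : EuclideanSpace ℝ (Fin d) → ℝ} {x : EuclideanSpace ℝ (Fin d)} {h v : ℕ → ℝ} {a C : ℝ}

theorem IsSample.measurable_gTilde (hs : IsSample P X Y f) (hK : Measurable K) (n : ℕ) :
    Measurable (gTilde K h X x n) := by
  have hX := hs.measurable_X
  refine Measurable.const_mul (Finset.measurable_fun_sum _ fun i _ => ?_) _
  exact (hK.comp (by fun_prop)).div_const _

theorem IsSample.measurable_centeredNumerator (hs : IsSample P X Y f) (hK : Measurable K)
    (r : EuclideanSpace ℝ (Fin q)) (n : ℕ) :
    Measurable (centeredNumerator K h v X Y x r n) := by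
  have hX := hs.measurable_X
  have hY := hs.measurable_Y
  have hm : Measurable (mTilde K h X Y x n) := by
    refine Measurable.fun_const_smul (Finset.measurable_fun_sum _ fun i _ => ?_) (n : ℝ)⁻¹
    exact ((hK.comp (by fun_prop)).div_const _).smul (hY i)
  exact (hm.sub ((hs.measurable_gTilde hK n).smul_const r)).fun_const_smul (v n)

theorem IsSample.eventually_abs_gTilde_sub_le [IsProbabilityMeasure P] (hs : IsSample P X Y f) (hK : A1 K)
    (hA2 : A2 f x)
    (hreg : RegularlyVaryingSeq h (-a)) (hh : ∀ n, 1 ≤ n → 0 < h n) (ha : 0 < a)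
    (hsup : ∀ n i : ℕ, 1 ≤ i → i ≤ n → h n / h i ≤ C) (hv : ∀ n, 1 ≤ n → 0 < v n)
    (hvt : Tendsto v atTop atTop)
    (hν : Tendsto (fun n : ℕ => (n : ℝ) * h n ^ d / v n ^ 2) atTop atTop)
    {δ : ℝ} (hδ : 0 < δ) (L : ℝ) :
    ∀ᶠ n : ℕ in atTop, P.real {ω | δ ≤ |gTilde K h X x n ω - marginal f x|}
      ≤ Real.exp (-((n : ℝ) * h n ^ d / v n ^ 2 * L)) := by
  have hcond : ∀ s : ℝ, (condIntegral f fun _ => s) = fun t => s * marginal f t := by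
    intro s
    ext t
    rw [condIntegral, marginal, integral_const_mul]
  have hcont : ∀ s : ℝ, ContinuousAt (condIntegral f fun _ => s) x := by
    intro s
    rw [hcond]
    exact hA2.continuousAt_marginal.const_mul s
  obtain ⟨CW, hCW⟩ : ∃ CW, ∀ s ∈ ({1, -1} : Set ℝ),
      UniformlyIntegrable f (fun _ : EuclideanSpace ℝ (Fin q) => Real.exp (2 * |s|)) CW := by
    obtain ⟨C₀, h0⟩ := hA2.uniformlyIntegrable_exp 0
    have h1 := h0.bounded
    simp only [inner_zero_left, Real.exp_zero, abs_one, one_mul] at h1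
    refine ⟨Real.exp 2 * C₀, fun s hs => ?_⟩
    have habs : |s| = 1 := by
      rcases hs with rfl | hs
      · exact abs_one
      · rw [Set.mem_singleton_iff.1 hs, abs_neg, abs_one]
    rw [habs, mul_one]
    refine ⟨measurable_const, fun t => (hA2.integrable_density t).const_mul _, fun t => ?_⟩
    rw [Real.abs_exp, integral_const_mul]
    exact mul_le_mul_of_nonneg_left (h1 t) (Real.exp_pos _).le
  filter_upwards [hs.eventually_gTilde_le hK hreg hh ha hsup hv hvt hν 1
      (hCW 1 (by simp)) (hcont 1) hδ (L + 1),
    hs.eventually_gTilde_le hK hreg hh ha hsup hv hvt hν (-1)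
      (hCW (-1) (by simp)) (hcont (-1)) hδ (L + 1),
    eventually_const_mul_exp_le hν (lt_add_one L) 2] with n h1 h2 h3
  rw [hcond] at h1 h2
  have hsub : {ω | δ ≤ |gTilde K h X x n ω - marginal f x|} ⊆
      {ω | 1 * marginal f x + δ ≤ 1 * gTilde K h X x n ω} ∪
      {ω | -1 * marginal f x + δ ≤ -1 * gTilde K h X x n ω} := by
    intro ω hω
    rcases le_abs.1 (show δ ≤ |gTilde K h X x n ω - marginal f x| from hω) with hle | hle
    · left
      change 1 * marginal f x + δ ≤ 1 * gTilde K h X x n ω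
      linarith
    · right
      change -1 * marginal f x + δ ≤ -1 * gTilde K h X x n ω
      linarith
  refine (measureReal_mono hsub).trans ((measureReal_union_le _ _).trans ?_)
  linarith

/-- The bias of the numerator is negligible at scale `v`. -/
theorem A5.tendsto_bias_mean {p : ℕ} (hA5 : A5 p K h v f x) (hK : A1 K) (hA2 : A2 f x)
    (hf : ∀ t y, 0 ≤ f t y) (hfm : Measurable (Function.uncurry f)) (hg : marginal f x ≠ 0)
    (hreg : RegularlyVaryingSeq h (-a)) (hh : ∀ n, 1 ≤ n → 0 < h n) (ha : 0 < a)
    (hsup : ∀ n i : ℕ, 1 ≤ i → i ≤ n → h n / h i ≤ C) (hv : ∀ n, 1 ≤ n → 0 < v n)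
    (hvn : Tendsto (fun n : ℕ => v n ^ 2 / n) atTop (𝓝 0)) (u : EuclideanSpace ℝ (Fin q)) :
    Tendsto (fun n : ℕ => v n * ((n : ℝ)⁻¹ * ∑ i ∈ Finset.Icc 1 n,
      |∫ z, K z * condIntegral f (fun y => inner ℝ u (y - regression f x)) (x - h i • z)|))
      atTop (𝓝 0) := by
  set r := regression f x with hr
  have hp := hA5.two_le
  obtain ⟨C₁, hC₁⟩ := exists_bias_bound hK (by omega) hA5.moment_eq_zero hA5.moment_integrable
    hA5.smooth_firstMoment (innerSL ℝ u)
  obtain ⟨C₂, hC₂⟩ := exists_bias_bound hK (by omega) hA5.moment_eq_zero hA5.moment_integrable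
    hA5.smooth_marginal (ContinuousLinearMap.id ℝ ℝ)
  simp only [innerSL_apply_apply, ContinuousLinearMap.id_apply] at hC₁ hC₂
  set c := inner ℝ u r with hc
  have hbound : ∀ i, 1 ≤ i →
      |∫ z, K z * condIntegral f (fun y => inner ℝ u (y - r)) (x - h i • z)|
        ≤ (C₁ + |c| * C₂) * h i ^ p := by
    intro i hi
    have hpi := hh i hi
    have hint₂ : Integrable fun z => K z * marginal f (x - h i • z) := by
      obtain ⟨C₀, h0⟩ := hA2.uniformlyIntegrable_exp 0
      have := h0.integrable_kernel hf hfm hK.integrable x (h i)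
      simpa [condIntegral, marginal] using this
    have hint : Integrable fun z => K z * condIntegral f (fun y => inner ℝ u (y - r))
        (x - h i • z) := by
      obtain ⟨C₀, h0⟩ := hA2.uniformlyIntegrable_exp_abs hf hfm u r
      exact (h0.of_exp hf hfm (ℓ := fun y => inner ℝ u (y - r)) (by fun_prop)).1.integrable_kernel
        hf hfm hK.integrable x (h i)
    have hint₁ : Integrable fun z => K z * inner ℝ u (firstMoment f (x - h i • z)) := by
      refine (hint.add (hint₂.const_mul c)).congr (ae_of_all _ fun z => ?_)
      simp only [Pi.add_apply]
      rw [hA2.condIntegral_inner hf hfm, ← hc]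
      ring
    have hdec : ∫ z, K z * condIntegral f (fun y => inner ℝ u (y - r)) (x - h i • z)
        = ((∫ z, K z * inner ℝ u (firstMoment f (x - h i • z))) - inner ℝ u (firstMoment f x))
          - c * ((∫ z, K z * marginal f (x - h i • z)) - marginal f x) := by
      have e1 : inner ℝ u (firstMoment f x) = c * marginal f x := by
        rw [hc, hr, regression, real_inner_smul_right]
        field_simp
      have e2 : ∫ z, K z * condIntegral f (fun y => inner ℝ u (y - r)) (x - h i • z)
          = (∫ z, K z * inner ℝ u (firstMoment f (x - h i • z)))
            - c * ∫ z, K z * marginal f (x - h i • z) := by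
        rw [← integral_const_mul, ← integral_sub hint₁ (hint₂.const_mul c)]
        congr 1
        ext z
        rw [hA2.condIntegral_inner hf hfm, ← hc]
        ring
      rw [e2, e1]
      ring
    rw [hdec]
    refine (abs_sub _ _).trans ?_
    rw [abs_mul, add_mul, mul_assoc]
    exact add_le_add (hC₁ _ hpi) (mul_le_mul_of_nonneg_left (hC₂ _ hpi) (abs_nonneg _))
  have hmean := (hreg.tendsto_mean_bias hh ha hsup hv hA5.tendsto_bias hvn).const_mul
    (C₁ + |c| * C₂)
  rw [mul_zero] at hmean
  refine squeeze_zero_norm' ?_ hmean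
  filter_upwards [eventually_ge_atTop 1] with n hn
  have hV := hv n hn
  rw [Real.norm_of_nonneg (mul_nonneg hV.le (mul_nonneg (by positivity)
    (Finset.sum_nonneg fun _ _ => abs_nonneg _))), mul_left_comm (C₁ + |c| * C₂),
    mul_left_comm (C₁ + |c| * C₂)]
  refine mul_le_mul_of_nonneg_left (mul_le_mul_of_nonneg_left ?_ (by positivity)) hV.le
  rw [Finset.mul_sum]
  exact Finset.sum_le_sum fun i hi => hbound i (Finset.mem_Icc.1 hi).1

end

end SemiRecursive

end

theorem theorem4 {d q : ℕ} (hd : 1 ≤ d) (hq : 1 ≤ q)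
    {Ω : Type*} [MeasurableSpace Ω] (P : Measure Ω) [IsProbabilityMeasure P]
    (X : ℕ → Ω → EuclideanSpace ℝ (Fin d)) (Y : ℕ → Ω → EuclideanSpace ℝ (Fin q))
    (f : EuclideanSpace ℝ (Fin d) → EuclideanSpace ℝ (Fin q) → ℝ)
    (hsample : SemiRecursive.IsSample P X Y f)
    (K : EuclideanSpace ℝ (Fin d) → ℝ) (x : EuclideanSpace ℝ (Fin d))
    (h v : ℕ → ℝ) (hh : ∀ n, 1 ≤ n → 0 < h n) (hv : ∀ n, 1 ≤ n → 0 < v n)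
    (a : ℝ) (ha0 : 0 < a) (ha1 : a < 1 / (d : ℝ))
    (hreg : SemiRecursive.RegularlyVaryingSeq h (-a))
    (hsup : ∃ C : ℝ, ∀ n i : ℕ, 1 ≤ i → i ≤ n → h n / h i ≤ C)
    (hA1 : SemiRecursive.A1 K) (hA2 : SemiRecursive.A2 f x) (hA3 : SemiRecursive.A3 f x)
    (hA4 : SemiRecursive.A4 d h v) (hA5 : ∃ p : ℕ, SemiRecursive.A5 p K h v f x) :
    (SemiRecursive.condCov f x).PosDef ∧
    SemiRecursive.LDPWithGoodRate P
      (fun n ω => v n • (SemiRecursive.rTilde K h X Y x n ω - SemiRecursive.regression f x))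
      (fun n : ℕ => (n : ℝ) * h n ^ d / v n ^ 2)
      (fun w => ((SemiRecursive.semiRecursiveRate a K f x w : ℝ) : EReal)) ∧
    (∀ w, SemiRecursive.nadarayaWatsonRate K f x w ≤ SemiRecursive.semiRecursiveRate a K f x w) ∧
    (∀ w, w ≠ 0 →
      SemiRecursive.nadarayaWatsonRate K f x w < SemiRecursive.semiRecursiveRate a K f x w) := by
  obtain ⟨C, hsup⟩ := hsup
  obtain ⟨p, hA5⟩ := hA5
  have hf := hsample.density_nonneg
  have hfm := hsample.measurable_density
  have hg : 0 < SemiRecursive.marginal f x :=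
    lt_of_le_of_ne (integral_nonneg (hf x)) (Ne.symm hA3.marginal_ne_zero)
  have hK2 := hA1.integral_sq_pos
  have hPD := hA2.posDef_condCov hf hfm hA3
  have hPDinv := hPD.inv
  have had : 0 < 1 + a * (d : ℝ) := by positivity
  set κ : ℝ := (∫ z, K z ^ 2) * SemiRecursive.marginal f x / (1 + a * d) with hκ
  have hκ0 : 0 < κ := by positivity
  set S := SemiRecursive.condCov f x with hS
  set T : EuclideanSpace ℝ (Fin q) →L[ℝ] EuclideanSpace ℝ (Fin q) :=
    κ • Matrix.toEuclideanCLM (𝕜 := ℝ) S with hTdef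
  set R : EuclideanSpace ℝ (Fin q) →L[ℝ] EuclideanSpace ℝ (Fin q) :=
    κ⁻¹ • Matrix.toEuclideanCLM (𝕜 := ℝ) S⁻¹ with hRdef
  have hTapp : ∀ u w : EuclideanSpace ℝ (Fin q),
      inner ℝ u (T w) = κ * (u.ofLp ⬝ᵥ S.mulVec w.ofLp) := fun u w => by
    rw [hTdef, smul_apply, real_inner_smul_right,
      SemiRecursive.inner_toEuclideanCLM]
  have hRapp : ∀ w : EuclideanSpace ℝ (Fin q),
      inner ℝ w (R w) = κ⁻¹ * SemiRecursive.precisionForm f x w := fun w => by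
    rw [hRdef, smul_apply, real_inner_smul_right,
      SemiRecursive.inner_toEuclideanCLM, SemiRecursive.precisionForm]
  have hform : ∀ w : EuclideanSpace ℝ (Fin q), w ≠ 0 →
      0 < SemiRecursive.precisionForm f x w := fun w hw => by
    have h1 := hPDinv.dotProduct_mulVec_pos (x := w.ofLp) (by simpa using hw)
    rwa [star_trivial] at h1
  have hrate : ∀ w, SemiRecursive.marginal f x ^ 2 / 2 * inner ℝ w (R w)
      = SemiRecursive.semiRecursiveRate a K f x w := fun w => by
    rw [hRapp, SemiRecursive.semiRecursiveRate, hκ]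
    field_simp
  have hν := hA4.tendsto_speed
  have hh0 : Tendsto h atTop (𝓝 0) := hreg.tendsto_zero hh ha0
  have hvn : Tendsto (fun n : ℕ => v n ^ 2 / n) atTop (𝓝 0) := by
    have h1 : Tendsto (fun n => h n ^ d) atTop (𝓝 0) := by
      simpa [show d ≠ 0 by omega] using hh0.pow d
    have h2 := h1.mul (tendsto_inv_atTop_zero.comp hν)
    rw [mul_zero] at h2
    refine h2.congr' ?_
    filter_upwards [eventually_ge_atTop 1] with n hn
    have hn' : (0 : ℝ) < n := by exact_mod_cast hn
    have hH := hh n hn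
    have hV := hv n hn
    simp only [Function.comp]
    field_simp
  have hlap : ∀ u : EuclideanSpace ℝ (Fin q), _ := fun u =>
    (hA2.uniformlyIntegrable_exp_abs hf hfm u (SemiRecursive.regression f x)).elim fun _ hCW =>
      hsample.tendsto_log_laplace (x := x) (v := v)
        (ℓ := fun y => inner ℝ u (y - SemiRecursive.regression f x))
        hd hA1 hreg hh ha0 hsup hv hA4.tendsto_v (by fun_prop) hCW
        (hA2.continuousAt_condIntegral_inner_sq hf hfm hA3 u _)
        (hA5.tendsto_bias_mean hA1 hA2 hf hfm hg.ne' hreg hh ha0 hsup hv hvn u)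
  refine ⟨hPD, ?_, fun w => ?_, fun w hw => ?_⟩
  · have hldp := SemiRecursive.ldp_ratio (P := P)
      (A := SemiRecursive.centeredNumerator K h v X Y x (SemiRecursive.regression f x))
      (Z := fun n ω => v n • (SemiRecursive.rTilde K h X Y x n ω - SemiRecursive.regression f x))
      (D := fun n ω => SemiRecursive.gTilde K h X x n ω) (T := T) (R := R) hν
      (fun u => by
        filter_upwards [(hlap u).1, eventually_ge_atTop 1] with n hn hn1
        simpa only [SemiRecursive.speed_mul_inner_centeredNumerator hh hv u _ hn1] using hn)
      (fun u => by
        have hlim : inner ℝ u (T u) / 2 = (∫ z, K z ^ 2) * SemiRecursive.condIntegral f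
            (fun y => inner ℝ u (y - SemiRecursive.regression f x) ^ 2) x / (1 + a * d) / 2 := by
          rw [hTapp, ← hA2.dotProduct_condCov hf hfm hg.ne' u, hκ]
          ring
        rw [hlim]
        refine (hlap u).2.congr' ?_
        filter_upwards [eventually_ge_atTop 1] with n hn1
        simp only [SemiRecursive.speed_mul_inner_centeredNumerator hh hv u _ hn1])
      hg (fun δ hδ L => hsample.eventually_abs_gTilde_sub_le hA1 hA2 hreg hh ha0 hsup hv
        hA4.tendsto_v hν hδ L)
      (fun n ω hD => by
        simp only [SemiRecursive.rTilde, SemiRecursive.centeredNumerator]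
        rw [if_pos hD, smul_comm, smul_sub (SemiRecursive.gTilde K h X x n ω)⁻¹, smul_smul,
          inv_mul_cancel₀ hD, one_smul])
      (fun n hn => by
        have hn' : (0 : ℝ) < n := by exact_mod_cast hn
        have hH := hh n hn
        have hV := hv n hn
        positivity)
      (fun n => hsample.measurable_centeredNumerator hA1.measurable _ n)
      (fun u hu => by
        rw [hTapp]
        have h1 := hPD.dotProduct_mulVec_pos (x := u.ofLp) (by simpa using hu)
        rw [star_trivial] at h1
        positivity)
      (fun u w => by
        rw [real_inner_comm w (T u), hTapp, hTapp, Matrix.dotProduct_mulVec,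
          ← Matrix.mulVec_transpose, dotProduct_comm]
        congr 3
        exact hPD.isHermitian)
      (fun w => by
        have hdet : IsUnit S.det := isUnit_iff_ne_zero.2 hPD.det_pos.ne'
        rw [hTdef, hRdef]
        simp only [smul_apply, map_smul, smul_smul]
        rw [inv_mul_cancel₀ hκ0.ne', one_smul, ← mul_apply_eq_comp, ← map_mul,
          Matrix.mul_nonsing_inv _ hdet, map_one, one_apply_eq_self])
    simpa only [hrate] using hldp
  · by_cases hw : w = 0
    · simp [hw, SemiRecursive.nadarayaWatsonRate, SemiRecursive.semiRecursiveRate,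
        SemiRecursive.precisionForm]
    · rw [SemiRecursive.nadarayaWatsonRate, SemiRecursive.semiRecursiveRate]
      have := hform w hw
      gcongr
      refine le_mul_of_one_le_left hg.le ?_
      have : 0 ≤ a * (d : ℝ) := by positivity
      linarith
  · rw [SemiRecursive.nadarayaWatsonRate, SemiRecursive.semiRecursiveRate]
    have := hform w hw
    gcongr
    have hd0 : (0 : ℝ) < d := by exact_mod_cast hd
    have : 0 < a * (d : ℝ) := by positivity
    nlinarith
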